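/- **Conventions.** Let $A$ be an abelian group. An *endogeny* of $A$ is a subgroup $\phi\le A\times A$ whose first projection is all of $A$ and whose *katakernel* $\operatorname{kat}(\phi)=\{b:(0,b)\in\phi\}$ is finite. For $B\le A$ put $\phi[B]=\{b:\exists a\in B\ (a,b)\in\phi\}$ and $\phi[a]=\{b:(a,b)\in\phi\}$. Endogenies are added, subtracted and composed as relations: $(\phi\pm\psi)[a]=\phi[a]\pm\psi[a]$, $(\phi\psi)[a]=\phi[\psi[a]]$. Write $\phi\sim\psi$ if $(\phi-\psi)[A]$ is finite. Two endogenies *sharply commute* if $(\phi\psi-\psi\phi)[A]\le\operatorname{kat}(\phi)+\operatorname{kat}(\psi)$, and sets of endogenies sharply commute if their elements do so pairwise. A *pre-ring* of endogenies is a set of endogenies that contains $0$ and the identity and is closed under sum, opposite and composition. For sets $\Gamma,\Delta$ of endogenies, $\operatorname{Kat}(\Gamma)=\sum_{\gamma\in\Gamma}\operatorname{kat}(\gamma)$ and the *bikatakernel* is $\operatorname{Kat}(\Gamma,\Delta)=\operatorname{Kat}(\Gamma)+\operatorname{Kat}(\Delta)$. A subgroup $B\le A$ is *$\Gamma$-invariant*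 if $\gamma[B]\le B$ for all $\gamma\in\Gamma$. A theory $T$ is *finite-dimensional* if there is a function $\dim$ from the interpretable sets of (sufficiently saturated) models of $T$ to $\omega\cup\{-\infty\}$ such that: $\dim\varphi(x,a)$ depends only on the formula $\varphi$ and on the type of $a$ over $\emptyset$; $\dim\emptyset=-\infty$, and a non-empty $X$ has $\dim X=0$ if and only if it is finite; $\dim(X\cup Y)=\max(\dim X,\dim Y)$; and for every interpretable $f:X\to Y$ and $k<\omega$, if $\dim f^{-1}(y)\ge k$ (respectively $\le k$) for all $y\in Y$, then $\dim X\ge\dim Y+k$ (respectively $\le\dim Y+k$). Let $M$ be a sufficiently saturated model of a finite-dimensional theory, $C\subset M$ a small set of parameters, $A$ an abelian group definable in $M$ over $C$, and $\Gamma,\Delta$ two pre-rings of definable endogenies of $A$ that are invariant over $C$, i.e. unions $\bigcup_i\{\varphi_i(x,y;b): b\models p_i\}$ with formulas $\varphi_i$ and partial types $p_i$ over $C$; for $N\succeq M$ let $\Gamma(N)$ be the union evaluated in $N$. Say that $\Gamma$ is *essentially infinite* if $\Gamma/{\sim}$ is infinite, and *essentially unbounded* if for every cardinal $\kappa$ there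 is $N\succeq M$ with $|\Gamma(N)/{\sim}|>\kappa$. Say that $A$ is *absolutely $(\Gamma,\Delta)$-minimal* if every infinite definable subgroup $B\le A$ such that $\gamma[B]\cap B$ has finite index in $\gamma[B]$ for all $\gamma\in\Gamma\cup\Delta$ has finite index in $A$. For a set $X$ of endogenies of $A$ let $C^{\#}(X)$ be the set of all definable endogenies of $A$ that sharply commute with every element of $X$. **Theorem A.** Assume that $\Gamma$ and $\Delta$ sharply commute, that $A$ is absolutely $(\Gamma,\Delta)$-minimal, and that one of $\Gamma,\Delta$ is essentially unbounded and the other is essentially infinite. Then: 1. $\operatorname{Kat}(\Gamma,\Delta)$ is finite; it is $\Gamma$-invariant and $\Delta$-invariant, and every element of $\Gamma\cup\Delta$ induces an endomorphism of $A/\operatorname{Kat}(\Gamma,\Delta)$. 2. The subgroup $F=\operatorname{Kat}\big(C^{\#}(C^{\#}(\Gamma)),C^{\#}(\Gamma)\big)$ is finite, contains $\operatorname{Kat}(\Gamma,\Delta)$, is $\Gamma$-invariant and $\Delta$-invariant, and $\Gamma/{\sim}$ and $\Delta/{\sim}$ act by endomorphisms on $A/F$: for $\Theta\in\{\Gamma,\Delta\}$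 there is a map $\rho:\Theta/{\sim}\to\operatorname{End}(A/F)$ respecting $0$, $1$, sums and products, with $\rho([\theta])(a+F)=b+F$ whenever $\theta\in\Theta$ and $(a,b)\in\theta$. (In particular, if $\Gamma=C^{\#}(\Delta)$ and $\Delta=C^{\#}(\Gamma)$, then $F=\operatorname{Kat}(\Gamma,\Delta)$.) -/

import Mathlib

open FirstOrder FirstOrder.Language Cardinal

universe u

namespace Endogenies

/-! ### Endogenies of an abelian group -/

section Group

variable {A : Type u} [AddCommGroup A]

/-- The katakernel `{b | (0, b) ∈ φ}` of an additive relation. -/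
def kat (φ : AddSubgroup (A × A)) : AddSubgroup A :=
  φ.comap (AddMonoidHom.inr A A)

/-- An endogeny: a subgroup of `A × A` with full first projection and finite katakernel. -/
def IsEndogeny (φ : AddSubgroup (A × A)) : Prop :=
  (∀ a : A, ∃ b : A, (a, b) ∈ φ) ∧ (kat φ : Set A).Finite

/-- The image `φ[B] = {b | ∃ a ∈ B, (a, b) ∈ φ}` of a subgroup `B`. -/
def image (φ : AddSubgroup (A × A)) (B : AddSubgroup A) : AddSubgroup A where
  carrier := {b | ∃ a ∈ B, (a, b) ∈ φ}
  zero_mem' := ⟨0, B.zero_mem, φ.zero_mem⟩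
  add_mem' := by
    rintro x y ⟨a, ha, hx⟩ ⟨b, hb, hy⟩
    exact ⟨a + b, B.add_mem ha hb, φ.add_mem hx hy⟩
  neg_mem' := by
    rintro x ⟨a, ha, hx⟩
    exact ⟨-a, B.neg_mem ha, φ.neg_mem hx⟩

/-- The zero endomorphism, as a graph. -/
def zeroE : AddSubgroup (A × A) := (0 : A →+ A).graph

/-- The identity, as a graph. -/
def oneE : AddSubgroup (A × A) := (AddMonoidHom.id A).graph

/-- The sum `a ↦ φ[a] + ψ[a]`. -/
def addE (φ ψ : AddSubgroup (A × A)) : AddSubgroup (A × A) where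
  carrier := {p | ∃ b c, (p.1, b) ∈ φ ∧ (p.1, c) ∈ ψ ∧ b + c = p.2}
  zero_mem' := ⟨0, 0, φ.zero_mem, ψ.zero_mem, by simp⟩
  add_mem' := by
    rintro x y ⟨b, c, hb, hc, h⟩ ⟨b', c', hb', hc', h'⟩
    refine ⟨b + b', c + c', φ.add_mem hb hb', ψ.add_mem hc hc', ?_⟩
    rw [Prod.snd_add, ← h, ← h']
    abel
  neg_mem' := by
    rintro x ⟨b, c, hb, hc, h⟩
    refine ⟨-b, -c, φ.neg_mem hb, ψ.neg_mem hc, ?_⟩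
    rw [Prod.snd_neg, ← h]
    abel

/-- The opposite `a ↦ -φ[a]`. -/
def negE (φ : AddSubgroup (A × A)) : AddSubgroup (A × A) where
  carrier := {p | (p.1, -p.2) ∈ φ}
  zero_mem' := by
    change ((0 : A), -(0 : A)) ∈ φ
    rw [neg_zero]
    exact φ.zero_mem
  add_mem' := by
    intro x y hx hy
    have h := φ.add_mem hx hy
    simpa [add_comm] using h
  neg_mem' := by
    intro x hx
    have h := φ.neg_mem hx
    simpa using h

/-- The difference `a ↦ φ[a] - ψ[a]`. -/
def subE (φ ψ : AddSubgroup (A × A)) : AddSubgroup (A × A) := addE φ (negE ψ)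

/-- The composition `a ↦ φ[ψ[a]]`. -/
def compE (φ ψ : AddSubgroup (A × A)) : AddSubgroup (A × A) where
  carrier := {p | ∃ z, (p.1, z) ∈ ψ ∧ (z, p.2) ∈ φ}
  zero_mem' := ⟨0, ψ.zero_mem, φ.zero_mem⟩
  add_mem' := by
    rintro x y ⟨z, h, h'⟩ ⟨w, k, k'⟩
    exact ⟨z + w, ψ.add_mem h k, φ.add_mem h' k'⟩
  neg_mem' := by
    rintro x ⟨z, h, h'⟩
    exact ⟨-z, ψ.neg_mem h, φ.neg_mem h'⟩

/-- `φ ∼ ψ`: the image of `φ - ψ` is finite. -/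
def Equivalent (φ ψ : AddSubgroup (A × A)) : Prop :=
  (image (subE φ ψ) ⊤ : Set A).Finite

/-- `Γ/∼`, for a set `Γ` of endogenies (on endogenies, `∼` is an equivalence relation). -/
def EssQuot (Γ : Set (AddSubgroup (A × A))) : Type u :=
  Quot fun γ γ' : Γ => Equivalent γ.1 γ'.1

/-- `Γ/∼` is infinite. -/
def EssentiallyInfinite (Γ : Set (AddSubgroup (A × A))) : Prop := Infinite (EssQuot Γ)

/-- `φ` and `ψ` sharply commute: the image of `φψ - ψφ` lies in `kat φ + kat ψ`. -/
def SharplyCommute (φ ψ : AddSubgroup (A × A)) : Prop :=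
  image (subE (compE φ ψ) (compE ψ φ)) ⊤ ≤ kat φ ⊔ kat ψ

/-- A pre-ring of endogenies: a set of endogenies that contains `0` and the identity and is closed
under sum, opposite and composition. -/
structure IsPreRing (Γ : Set (AddSubgroup (A × A))) : Prop where
  isEndogeny : ∀ γ ∈ Γ, IsEndogeny γ
  zero_mem : zeroE ∈ Γ
  one_mem : oneE ∈ Γ
  add_mem : ∀ γ ∈ Γ, ∀ γ' ∈ Γ, addE γ γ' ∈ Γ
  neg_mem : ∀ γ ∈ Γ, negE γ ∈ Γ
  comp_mem : ∀ γ ∈ Γ, ∀ γ' ∈ Γ, compE γ γ' ∈ Γ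

/-- `B` is `Γ`-invariant: `γ[B] ≤ B` for all `γ ∈ Γ`. -/
def IsInvariant (Γ : Set (AddSubgroup (A × A))) (B : AddSubgroup A) : Prop :=
  ∀ γ ∈ Γ, image γ B ≤ B

/-- `B` is almost `Γ`-invariant: `γ[B] ∩ B` has finite index in `γ[B]` for all `γ ∈ Γ`. -/
def IsAlmostInvariant (Γ : Set (AddSubgroup (A × A))) (B : AddSubgroup A) : Prop :=
  ∀ γ ∈ Γ, B.relIndex (image γ B) ≠ 0

/-- The global katakernel `∑ γ ∈ Γ, kat γ`. -/
def Kat (Γ : Set (AddSubgroup (A × A))) : AddSubgroup A := ⨆ γ ∈ Γ, kat γ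

/-- The global bikatakernel. -/
def biKat (Γ Δ : Set (AddSubgroup (A × A))) : AddSubgroup A := Kat Γ ⊔ Kat Δ

/-- The relation `γ` induces an endomorphism of `A/F`. -/
def InducesEndomorphism (γ : AddSubgroup (A × A)) (F : AddSubgroup A) : Prop :=
  ∃ g : A ⧸ F →+ A ⧸ F, ∀ a b : A, (a, b) ∈ γ → g (a : A ⧸ F) = (b : A ⧸ F)

/-- `Γ/∼` acts by endomorphisms on `A/F`: there is a map `ρ` from `Γ/∼` to the endomorphism ring
of `A/F` that is given by `ρ [γ] (a + F) = γ[a] + F` and respects `0`, `1`, sums and products. -/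
def QuotActsByEndomorphisms (Γ : Set (AddSubgroup (A × A))) (F : AddSubgroup A) : Prop :=
  ∃ ρ : EssQuot Γ → AddMonoid.End (A ⧸ F),
    (∀ (γ : Γ) (a b : A), (a, b) ∈ γ.1 → ρ (Quot.mk _ γ) (a : A ⧸ F) = (b : A ⧸ F)) ∧
    (∀ γ : Γ, γ.1 = zeroE → ρ (Quot.mk _ γ) = 0) ∧
    (∀ γ : Γ, γ.1 = oneE → ρ (Quot.mk _ γ) = 1) ∧
    (∀ γ₁ γ₂ γ₃ : Γ, γ₃.1 = addE γ₁.1 γ₂.1 →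
      ρ (Quot.mk _ γ₃) = ρ (Quot.mk _ γ₁) + ρ (Quot.mk _ γ₂)) ∧
    (∀ γ₁ γ₂ γ₃ : Γ, γ₃.1 = compE γ₁.1 γ₂.1 →
      ρ (Quot.mk _ γ₃) = ρ (Quot.mk _ γ₁) * ρ (Quot.mk _ γ₂))

end Group

/-! ### Saturated models and finite-dimensional theories -/

/-- `M` is `κ`-saturated: a partial type in finitely many variables, over fewer than `κ` parameters
from `M`, is realized in `M` as soon as it is finitely satisfiable in `M`. -/
def IsSaturated (L : FirstOrder.Language.{u, u}) (κ : Cardinal.{u}) (M : Type u) [L.Structure M] : Prop :=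
  ∀ B : Set M, #B < κ → ∀ (m : ℕ) (p : Set (L.Formula (B ⊕ Fin m))),
    (∀ q ⊆ p, q.Finite → ∃ x : Fin m → M, ∀ ψ ∈ q, ψ.Realize (Sum.elim Subtype.val x)) →
      ∃ x : Fin m → M, ∀ ψ ∈ p, ψ.Realize (Sum.elim Subtype.val x)

section Interpretable

variable (L : FirstOrder.Language.{u, u}) {N : Type u} [L.Structure N]

/-- `S`, a set of classes of an equivalence relation `E` on `N ^ n`, is an interpretable set:
`E` and the union of the classes in `S` are definable, with parameters. -/
def IsInterpretable {n : ℕ} (E : Setoid (Fin n → N)) (S : Set (Quotient E)) : Prop :=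
  (Set.univ : Set N).Definable L {v : Fin n ⊕ Fin n → N | E (v ∘ Sum.inl) (v ∘ Sum.inr)} ∧
  (Set.univ : Set N).Definable L {x : Fin n → N | Quotient.mk E x ∈ S}

/-- `f` maps the interpretable set `S` to the interpretable set `S'`, and its restriction to `S` is
an interpretable function (values of `f` outside `S` are irrelevant). -/
def IsInterpretableMap {n m : ℕ} {E : Setoid (Fin n → N)} {E' : Setoid (Fin m → N)}
    (S : Set (Quotient E)) (S' : Set (Quotient E')) (f : Quotient E → Quotient E') : Prop :=
  Set.MapsTo f S S' ∧
  (Set.univ : Set N).Definable L {v : Fin n ⊕ Fin m → N |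
    Quotient.mk E (v ∘ Sum.inl) ∈ S ∧
      f (Quotient.mk E (v ∘ Sum.inl)) = Quotient.mk E' (v ∘ Sum.inr)}

/-- `S` is the interpretable set defined by the formula `φ(x, a)` modulo the equivalence relation
defined by `ε(x, x', a)`. -/
def IsDefinedBy {n k : ℕ} (φ : L.Formula (Fin k ⊕ Fin n))
    (ε : L.Formula (Fin k ⊕ (Fin n ⊕ Fin n))) (a : Fin k → N)
    (E : Setoid (Fin n → N)) (S : Set (Quotient E)) : Prop :=
  (∀ x y : Fin n → N, E x y ↔ ε.Realize (Sum.elim a (Sum.elim x y))) ∧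
  (∀ x : Fin n → N, Quotient.mk E x ∈ S ↔ φ.Realize (Sum.elim a x))

end Interpretable

/-- A dimension function for the theory `T`: it assigns a value in `ω ∪ {-∞}` to the interpretable
sets of the models of `T`. As usual, "for all points of an interpretable set" has its meaning in
models that realize all types over finitely many parameters, so that the axioms are only asked of
`ℵ₀`-saturated models (to ask them of all models would be a stronger hypothesis on `T`). -/
structure DimensionFunction {L : FirstOrder.Language.{u, u}} (T : L.Theory) where
  /-- the dimension -/
  dim : ∀ (N : Type u) [L.Structure N] {n : ℕ} (E : Setoid (Fin n → N)),
    Set (Quotient E) → WithBot ℕ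
  /-- The dimension of `φ(x, a)` depends only on the formula and on the type of `a` over `∅`. -/
  invariance : ∀ (N : Type u) [L.Structure N] [Nonempty N] (N' : Type u) [L.Structure N']
    [Nonempty N'], N ⊨ T → N' ⊨ T → IsSaturated L ℵ₀ N → IsSaturated L ℵ₀ N' →
    ∀ {n k : ℕ} (φ : L.Formula (Fin k ⊕ Fin n)) (ε : L.Formula (Fin k ⊕ (Fin n ⊕ Fin n)))
      (a : Fin k → N) (a' : Fin k → N'),
      (∀ ψ : L.Formula (Fin k), ψ.Realize a ↔ ψ.Realize a') →
      ∀ (E : Setoid (Fin n → N)) (S : Set (Quotient E)) (E' : Setoid (Fin n → N'))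
        (S' : Set (Quotient E')),
        IsDefinedBy L φ ε a E S → IsDefinedBy L φ ε a' E' S' → dim N E S = dim N' E' S'
  dim_empty : ∀ (N : Type u) [L.Structure N] [Nonempty N], N ⊨ T → IsSaturated L ℵ₀ N →
    ∀ {n : ℕ} (E : Setoid (Fin n → N)), IsInterpretable L E ∅ → dim N E ∅ = ⊥
  dim_eq_zero_iff : ∀ (N : Type u) [L.Structure N] [Nonempty N], N ⊨ T → IsSaturated L ℵ₀ N →
    ∀ {n : ℕ} (E : Setoid (Fin n → N)) (S : Set (Quotient E)), IsInterpretable L E S →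
      S.Nonempty → (dim N E S = 0 ↔ S.Finite)
  dim_union : ∀ (N : Type u) [L.Structure N] [Nonempty N], N ⊨ T → IsSaturated L ℵ₀ N →
    ∀ {n : ℕ} (E : Setoid (Fin n → N)) (S S' : Set (Quotient E)),
      IsInterpretable L E S → IsInterpretable L E S' →
        dim N E (S ∪ S') = max (dim N E S) (dim N E S')
  le_dim : ∀ (N : Type u) [L.Structure N] [Nonempty N], N ⊨ T → IsSaturated L ℵ₀ N →
    ∀ {n m : ℕ} (E : Setoid (Fin n → N)) (E' : Setoid (Fin m → N)) (S : Set (Quotient E))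
      (S' : Set (Quotient E')) (f : Quotient E → Quotient E'),
      IsInterpretable L E S → IsInterpretable L E' S' → IsInterpretableMap L S S' f →
      ∀ k : ℕ, (∀ y ∈ S', (k : WithBot ℕ) ≤ dim N E (S ∩ f ⁻¹' {y})) →
        dim N E' S' + (k : WithBot ℕ) ≤ dim N E S
  dim_le : ∀ (N : Type u) [L.Structure N] [Nonempty N], N ⊨ T → IsSaturated L ℵ₀ N →
    ∀ {n m : ℕ} (E : Setoid (Fin n → N)) (E' : Setoid (Fin m → N)) (S : Set (Quotient E))
      (S' : Set (Quotient E')) (f : Quotient E → Quotient E'),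
      IsInterpretable L E S → IsInterpretable L E' S' → IsInterpretableMap L S S' f →
      ∀ k : ℕ, (∀ y ∈ S', dim N E (S ∩ f ⁻¹' {y}) ≤ (k : WithBot ℕ)) →
        dim N E S ≤ dim N E' S' + (k : WithBot ℕ)

/-- The theory `T` is finite-dimensional. -/
def IsFiniteDimensional {L : FirstOrder.Language.{u, u}} (T : L.Theory) : Prop :=
  Nonempty (DimensionFunction T)

/-! ### Definable groups and invariant families of definable relations -/

/-- An abelian group that is definable in `M` over `C`: its elements are the realizations in `M ^ n`
of a formula over `C`, and its addition is given by a formula over `C`. -/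
structure DefAbGroup (L : FirstOrder.Language.{u, u}) {M : Type u} [L.Structure M] (C : Set M) (n : ℕ) where
  /-- formula for the underlying set -/
  dom : L.Formula (C ⊕ Fin n)
  /-- formula for the graph of the addition -/
  add : L.Formula (C ⊕ (Fin n ⊕ (Fin n ⊕ Fin n)))
  /-- the group structure -/
  group : AddCommGroup {x : Fin n → M // dom.Realize (Sum.elim Subtype.val x)}
  add_iff : ∀ x y z : {x : Fin n → M // dom.Realize (Sum.elim Subtype.val x)},
    add.Realize (Sum.elim Subtype.val (Sum.elim x.1 (Sum.elim y.1 z.1))) ↔ x + y = z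

/-- An invariant (over `C`) family of definable binary relations between `n`-tuples: a union, over
`i : ι`, of type-definable families `{φ_i(x, y, b) : b realizes p_i}`, where `φ_i` is a formula and
`p_i` a partial type in finitely many variables, both over `C`. -/
structure InvariantFamily (L : FirstOrder.Language.{u, u}) {M : Type u} (C : Set M) (n : ℕ) where
  /-- the index set of the union -/
  ι : Type u
  /-- the number of parameter variables -/
  arity : ι → ℕ
  /-- the formulas `φ_i(x, y, z)` -/
  formula : ∀ i, L.Formula (C ⊕ (Fin (arity i) ⊕ (Fin n ⊕ Fin n)))
  /-- the partial types `p_i(z)` -/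
  type : ∀ i, Set (L.Formula (C ⊕ Fin (arity i)))

namespace InvariantFamily

variable {L : FirstOrder.Language.{u, u}} {M : Type u} {C : Set M} {n : ℕ}

/-- The members of the family in a structure `N`, where `c` interprets the parameters from `C`. -/
def members (Γ : InvariantFamily L C n) {N : Type u} [L.Structure N] (c : C → N) :
    Set (Set ((Fin n → N) × (Fin n → N))) :=
  {R | ∃ (i : Γ.ι) (b : Fin (Γ.arity i) → N), (∀ ψ ∈ Γ.type i, ψ.Realize (Sum.elim c b)) ∧
    R = {xy | (Γ.formula i).Realize (Sum.elim c (Sum.elim b (Sum.elim xy.1 xy.2)))}}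

end InvariantFamily

namespace DefAbGroup

variable {L : FirstOrder.Language.{u, u}} {M : Type u} [L.Structure M] {C : Set M} {n : ℕ}

/-- The underlying set of the group in `M`. -/
abbrev Carrier (G : DefAbGroup L C n) : Type u :=
  {x : Fin n → M // G.dom.Realize (Sum.elim Subtype.val x)}

instance (G : DefAbGroup L C n) : AddCommGroup G.Carrier := G.group

/-- A relation on the group as a relation between `n`-tuples of elements of `M`. -/
def pairs (G : DefAbGroup L C n) (γ : AddSubgroup (G.Carrier × G.Carrier)) :
    Set ((Fin n → M) × (Fin n → M)) :=
  {xy | ∃ p ∈ γ, p.1.1 = xy.1 ∧ p.2.1 = xy.2}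

/-- A subgroup is definable, with parameters from `M`. -/
def IsDefinableSubgroup (G : DefAbGroup L C n) (B : AddSubgroup G.Carrier) : Prop :=
  (Set.univ : Set M).Definable L {x : Fin n → M | ∃ b ∈ B, b.1 = x}

/-- The definable (with parameters from `M`) endogenies. -/
def defEndog (G : DefAbGroup L C n) : Set (AddSubgroup (G.Carrier × G.Carrier)) :=
  {φ | IsEndogeny φ ∧ (Set.univ : Set M).Definable L
    {v : Fin n ⊕ Fin n → M | (v ∘ Sum.inl, v ∘ Sum.inr) ∈ G.pairs φ}}

/-- `C^#(X)`: the definable endogenies that sharply commute with all elements of `X`. -/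
def sharpCentralizer (G : DefAbGroup L C n) (X : Set (AddSubgroup (G.Carrier × G.Carrier))) :
    Set (AddSubgroup (G.Carrier × G.Carrier)) :=
  {φ ∈ G.defEndog | ∀ ψ ∈ X, SharplyCommute φ ψ}

/-- The subgroups of `A × A` that belong to the invariant family `Γ`. -/
def elements (G : DefAbGroup L C n) (Γ : InvariantFamily L C n) :
    Set (AddSubgroup (G.Carrier × G.Carrier)) :=
  {γ | G.pairs γ ∈ Γ.members (Subtype.val : C → M)}

/-- The invariant family `Γ` is an invariant pre-ring of (definable) endogenies: all its members
are endogenies of the group, and they form a pre-ring. -/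
def IsInvariantPreRing (G : DefAbGroup L C n) (Γ : InvariantFamily L C n) : Prop :=
  (∀ R ∈ Γ.members (Subtype.val : C → M), ∃ γ, IsEndogeny γ ∧ G.pairs γ = R) ∧
    IsPreRing (G.elements Γ)

/-- No infinite definable almost `Γ`-invariant subgroup has infinite index. -/
def AbsolutelyMinimal (G : DefAbGroup L C n)
    (Γ : Set (AddSubgroup (G.Carrier × G.Carrier))) : Prop :=
  ∀ B : AddSubgroup G.Carrier, G.IsDefinableSubgroup B → (B : Set G.Carrier).Infinite →
    IsAlmostInvariant Γ B → B.index ≠ 0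

/-- In an elementary extension `N` of `M`, the set `(R - S)[A(N)]` of all `z ∈ A(N)` such that
`z + y' = y` for some `x`, `y`, `y'` with `(x, y) ∈ R` and `(x, y') ∈ S`. -/
def differenceImage (G : DefAbGroup L C n) {N : Type u} [L.Structure N] (c : C → N)
    (R S : Set ((Fin n → N) × (Fin n → N))) : Set (Fin n → N) :=
  {z | G.dom.Realize (Sum.elim c z) ∧ ∃ x y y', (x, y) ∈ R ∧ (x, y') ∈ S ∧
    G.add.Realize (Sum.elim c (Sum.elim z (Sum.elim y' y)))}

/-- `Γ` is essentially unbounded: the cardinality of `Γ(N)/∼` is arbitrarily large when `N` runs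
over the elementary extensions of `M`. -/
def EssentiallyUnbounded (G : DefAbGroup L C n) (Γ : InvariantFamily L C n) : Prop :=
  ∀ κ : Cardinal.{u}, ∃ (N : Type u) (_ : L.Structure N) (f : M ↪ₑ[L] N),
    κ < #(Quot fun R S : Γ.members (fun c : C => f c) =>
      (G.differenceImage (fun c : C => f c) R.1 S.1).Finite)

end DefAbGroup

end Endogenies

open Endogenies

/-!
Let `Γ` and `Δ` sharply commute. For `x ∈ kat γ` and `δ ∈ Δ` one has `δ[x] ≤ kat γ + kat δ`, so `δ`
has a value at `x` in the finite group `kat γ`. Hence two among more than `|kat γ|` elements of `Δ`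
have a common value at `x`, that is, `x` lies in the kernel of their difference. These kernels are
definable and almost `Γ`-invariant, and they are of infinite index if the elements of `Δ` are
inequivalent. Minimality allows to iterate this: the `Γ`-translates of an infinite almost
`Δ`-invariant subgroup `B` generate `A` up to finite index, and finitely many of them suffice because
the dimension is bounded (`IsMinimalPair.exists_almostLe_sup_image`), so a pre-ring with many
inequivalent elements has many inequivalent elements on `B` (`IsMinimalPair.hasManyOn`). By induction
on the dimension, the katakernels of bounded size have finite union
(`IsMinimalPair.finite_kat_of_card_le`). As a consequence the bikatakernel `Y` is countable.

If `Γ` is essentially unbounded, one of the type-definable parts of `Γ` has arbitrarily many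
pairwise inequivalent members. Since `Y` is `Γ`-invariant and countable, compactness and saturation
give two inequivalent members with a common value at every point of `Y`; their difference has
infinite image and kills `Y` (`DefAbGroup.HasManyMembers.exists_ker_le`). The elements that kill `Y`
form a two-sided ideal, and a second induction on the dimension shows that `Y` is finite
(`IsMinimalPair.finite_of_le_ker`).

All of this applies to any minimal pair of pre-rings that contains an essentially unbounded invariant
pre-ring on one side, in particular to `C^#(C^#(Γ))` and `C^#(Γ)`. Finally, if `K = (θ - θ')[A]` is
finite, the constant relation `a ↦ K` sharply commutes with everything that `θ` and `θ'` sharply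
commute with, so that `K` lies in the bikatakernel `F` of the double sharp centralizer and the sharp
centralizer (`DefAbGroup.image_subE_le_Kat`); this is why the action on `A/F` factors through `∼`.
-/

namespace Endogenies

open scoped Pointwise

/-! ### The calculus of additive relations -/

section Relations

variable {A : Type u} [AddCommGroup A] {φ ψ χ : AddSubgroup (A × A)} {B C D : AddSubgroup A}

/-- The kernel `{a | (a, 0) ∈ φ}` of an additive relation. -/
def ker (φ : AddSubgroup (A × A)) : AddSubgroup A :=
  φ.comap (AddMonoidHom.inl A A)

theorem mem_ker {a : A} : a ∈ ker φ ↔ (a, 0) ∈ φ := Iff.rfl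

theorem mem_kat {b : A} : b ∈ kat φ ↔ (0, b) ∈ φ := Iff.rfl

theorem mem_image {b : A} : b ∈ image φ B ↔ ∃ a ∈ B, (a, b) ∈ φ := Iff.rfl

theorem mem_addE {a b : A} :
    (a, b) ∈ addE φ ψ ↔ ∃ x y, (a, x) ∈ φ ∧ (a, y) ∈ ψ ∧ x + y = b := Iff.rfl

theorem mem_negE {a b : A} : (a, b) ∈ negE φ ↔ (a, -b) ∈ φ := Iff.rfl

theorem mem_compE {a b : A} : (a, b) ∈ compE φ ψ ↔ ∃ z, (a, z) ∈ ψ ∧ (z, b) ∈ φ := Iff.rfl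

theorem mem_zeroE {a b : A} : (a, b) ∈ zeroE ↔ b = 0 := by
  simp [zeroE, AddMonoidHom.mem_graph, eq_comm]

theorem mem_oneE {a b : A} : (a, b) ∈ oneE ↔ a = b := by
  simp [oneE, AddMonoidHom.mem_graph]

theorem mem_subE {a b : A} :
    (a, b) ∈ subE φ ψ ↔ ∃ x y, (a, x) ∈ φ ∧ (a, y) ∈ ψ ∧ x - y = b := by
  constructor
  · rintro ⟨x, y, hx, hy, h⟩
    exact ⟨x, -y, hx, hy, by rw [sub_neg_eq_add]; exact h⟩
  · rintro ⟨x, y, hx, hy, h⟩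
    exact ⟨x, -y, hx, by rwa [mem_negE, neg_neg], by rw [← h, sub_eq_add_neg]⟩

theorem sub_mem_kat {a b b' : A} (h : (a, b) ∈ φ) (h' : (a, b') ∈ φ) : b - b' ∈ kat φ := by
  simpa [mem_kat] using φ.sub_mem h h'

theorem kat_addE : kat (addE φ ψ) = kat φ ⊔ kat ψ := by
  ext b
  simp only [mem_kat, mem_addE, AddSubgroup.mem_sup]
  grind

theorem kat_negE : kat (negE φ) = kat φ := by
  ext b
  rw [mem_kat, mem_negE, ← mem_kat, neg_mem_iff]

theorem kat_compE : kat (compE φ ψ) = image φ (kat ψ) := rfl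

theorem kat_zeroE : kat (zeroE : AddSubgroup (A × A)) = ⊥ := by
  ext b
  rw [mem_kat, mem_zeroE, AddSubgroup.mem_bot]

theorem kat_oneE : kat (oneE : AddSubgroup (A × A)) = ⊥ := by
  ext b
  rw [mem_kat, mem_oneE, AddSubgroup.mem_bot, eq_comm]

theorem image_mono (h : B ≤ C) : image φ B ≤ image φ C :=
  fun _ ⟨a, ha, hx⟩ => ⟨a, h ha, hx⟩

theorem image_sup (hφ : IsEndogeny φ) : image φ (B ⊔ C) = image φ B ⊔ image φ C := by
  refine le_antisymm ?_ (sup_le (image_mono le_sup_left) (image_mono le_sup_right))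
  rintro x ⟨a, ha, hx⟩
  obtain ⟨b, hb, c, hc, rfl⟩ := AddSubgroup.mem_sup.1 ha
  obtain ⟨y, hy⟩ := hφ.1 b
  exact AddSubgroup.mem_sup.2 ⟨y, ⟨b, hb, hy⟩, x - y, ⟨c, hc, by simpa using φ.sub_mem hx hy⟩,
    by simp⟩

theorem image_compE : image (compE φ ψ) B = image φ (image ψ B) := by
  ext b
  simp only [mem_image, mem_compE]
  grind

theorem kat_le_image : kat φ ≤ image φ B := fun _ h => ⟨0, B.zero_mem, h⟩

theorem finite_sup (hB : (B : Set A).Finite) (hC : (C : Set A).Finite) :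
    ((B ⊔ C : AddSubgroup A) : Set A).Finite := by
  refine (hB.add hC).subset fun x hx => ?_
  obtain ⟨y, hy, z, hz, h⟩ := AddSubgroup.mem_sup.1 hx
  exact ⟨y, hy, z, hz, h⟩

/-- The image of a finite set under a relation with finite katakernel is finite. -/
theorem finite_relation_image (hφ : (kat φ : Set A).Finite) {S : Set A} (hS : S.Finite) :
    {b | ∃ a ∈ S, (a, b) ∈ φ}.Finite := by
  have : {b | ∃ a ∈ S, (a, b) ∈ φ} = ⋃ a ∈ S, {b | (a, b) ∈ φ} := by ext; simp
  rw [this]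
  refine hS.biUnion fun a _ => ?_
  by_cases h : ∃ b, (a, b) ∈ φ
  · obtain ⟨b, hb⟩ := h
    refine (hφ.image (fun k => k + b)).subset fun b' hb' => ?_
    exact ⟨b' - b, sub_mem_kat hb' hb, by simp⟩
  · convert Set.finite_empty
    ext b
    simpa using fun hb => h ⟨b, hb⟩

theorem finite_image (hφ : IsEndogeny φ) (hB : (B : Set A).Finite) :
    (image φ B : Set A).Finite :=
  finite_relation_image hφ.2 hB

namespace IsEndogeny

theorem addE (hφ : IsEndogeny φ) (hψ : IsEndogeny ψ) : IsEndogeny (addE φ ψ) := by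
  refine ⟨fun a => ?_, ?_⟩
  · obtain ⟨x, hx⟩ := hφ.1 a
    obtain ⟨y, hy⟩ := hψ.1 a
    exact ⟨x + y, x, y, hx, hy, rfl⟩
  · rw [kat_addE]
    exact finite_sup hφ.2 hψ.2

theorem negE (hφ : IsEndogeny φ) : IsEndogeny (negE φ) := by
  refine ⟨fun a => ?_, ?_⟩
  · obtain ⟨x, hx⟩ := hφ.1 a
    exact ⟨-x, by rwa [mem_negE, neg_neg]⟩
  · rw [kat_negE]
    exact hφ.2

theorem subE (hφ : IsEndogeny φ) (hψ : IsEndogeny ψ) : IsEndogeny (subE φ ψ) :=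
  hφ.addE hψ.negE

theorem compE (hφ : IsEndogeny φ) (hψ : IsEndogeny ψ) : IsEndogeny (compE φ ψ) := by
  refine ⟨fun a => ?_, finite_image hφ hψ.2⟩
  obtain ⟨x, hx⟩ := hψ.1 a
  obtain ⟨y, hy⟩ := hφ.1 x
  exact ⟨y, x, hx, hy⟩

theorem zeroE : IsEndogeny (zeroE : AddSubgroup (A × A)) :=
  ⟨fun _ => ⟨0, mem_zeroE.2 rfl⟩, by rw [kat_zeroE]; simp⟩

theorem oneE : IsEndogeny (oneE : AddSubgroup (A × A)) :=
  ⟨fun a => ⟨a, mem_oneE.2 rfl⟩, by rw [kat_oneE]; simp⟩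

end IsEndogeny

theorem IsPreRing.sub_mem {Γ : Set (AddSubgroup (A × A))} (hΓ : IsPreRing Γ) (hφ : φ ∈ Γ)
    (hψ : ψ ∈ Γ) : subE φ ψ ∈ Γ :=
  hΓ.add_mem _ hφ _ (hΓ.neg_mem _ hψ)

/-! ### Sharp commutation -/

/-- Sharp commutation, read off at the points: the values of `φψ` and `ψφ` at `a` agree modulo
`kat φ + kat ψ`. -/
theorem sharplyCommute_iff : SharplyCommute φ ψ ↔ ∀ a z x w y, (a, z) ∈ ψ → (z, x) ∈ φ →
    (a, w) ∈ φ → (w, y) ∈ ψ → x - y ∈ kat φ ⊔ kat ψ := by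
  constructor
  · intro h a z x w y h1 h2 h3 h4
    exact h ⟨a, trivial, mem_subE.2 ⟨x, y, ⟨z, h1, h2⟩, ⟨w, h3, h4⟩, rfl⟩⟩
  · rintro h _ ⟨a, -, hb⟩
    obtain ⟨x, y, ⟨z, h1, h2⟩, ⟨w, h3, h4⟩, rfl⟩ := mem_subE.1 hb
    exact h a z x w y h1 h2 h3 h4

theorem SharplyCommute.symm (h : SharplyCommute φ ψ) : SharplyCommute ψ φ := by
  rw [sharplyCommute_iff] at h ⊢
  intro a z x w y h1 h2 h3 h4
  rw [sup_comm, ← neg_mem_iff, neg_sub]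
  exact h a w y z x h3 h4 h1 h2

theorem SharplyCommute.image_kat_le (h : SharplyCommute φ ψ) :
    image φ (kat ψ) ≤ kat φ ⊔ kat ψ := by
  rintro x ⟨z, hz, hx⟩
  simpa using sharplyCommute_iff.1 h 0 z x 0 0 hz hx φ.zero_mem ψ.zero_mem

theorem SharplyCommute.addE (hψ : IsEndogeny ψ) (h : SharplyCommute φ ψ)
    (h' : SharplyCommute χ ψ) : SharplyCommute (addE φ χ) ψ := by
  rw [sharplyCommute_iff, kat_addE]
  rintro a z x w y h1 ⟨u, v, hu, hv, rfl : u + v = x⟩ ⟨s, t, hs, ht, rfl : s + t = w⟩ h4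
  obtain ⟨y₁, hy₁⟩ := hψ.1 s
  have hy₂ : (t, y - y₁) ∈ ψ := by simpa using ψ.sub_mem h4 hy₁
  have e : u + v - y = (u - y₁) + (v - (y - y₁)) := by abel
  rw [e]
  refine add_mem ?_ ?_
  · exact sup_le_sup_right (le_sup_left : kat φ ≤ _) (kat ψ)
      (sharplyCommute_iff.1 h a z u s y₁ h1 hu hs hy₁)
  · exact sup_le_sup_right (le_sup_right : kat χ ≤ _) (kat ψ)
      (sharplyCommute_iff.1 h' a z v t _ h1 hv ht hy₂)

theorem SharplyCommute.negE (h : SharplyCommute φ ψ) : SharplyCommute (negE φ) ψ := by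
  rw [sharplyCommute_iff, kat_negE]
  intro a z x w y h1 h2 h3 h4
  have := sharplyCommute_iff.1 h a z (-x) (-w) (-y) h1 h2 h3 (by simpa using ψ.neg_mem h4)
  rw [← neg_mem_iff]
  convert this using 1
  abel

theorem SharplyCommute.compE (hφ : IsEndogeny φ) (hψ : IsEndogeny ψ)
    (h : SharplyCommute φ ψ) (h' : SharplyCommute χ ψ) : SharplyCommute (compE φ χ) ψ := by
  rw [sharplyCommute_iff, kat_compE]
  rintro a z x w y h1 ⟨z', hz', hx⟩ ⟨w', hw', hw⟩ h4
  -- `v` is a value of `ψχ` at `a`, and `x'` a value of `φ` at `v`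
  obtain ⟨v, hv⟩ := hψ.1 w'
  obtain ⟨x', hx'⟩ := hφ.1 v
  have k1 := sharplyCommute_iff.1 h' a z z' w' v h1 hz' hw' hv
  have k2 := sharplyCommute_iff.1 h w' v x' w y hv hx' hw h4
  have k3 : x - x' ∈ image φ (kat χ ⊔ kat ψ) := ⟨_, k1, by simpa using φ.sub_mem hx hx'⟩
  have k4 : kat φ ⊔ kat ψ ≤ image φ (kat χ) ⊔ kat ψ := sup_le_sup_right kat_le_image _
  rw [image_sup hφ] at k3
  have k5 : image φ (kat χ) ⊔ image φ (kat ψ) ≤ image φ (kat χ) ⊔ kat ψ :=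
    sup_le le_sup_left (h.image_kat_le.trans k4)
  rw [← sub_add_sub_cancel x x' y]
  exact add_mem (k5 k3) (k4 k2)

theorem sharplyCommute_zeroE : SharplyCommute zeroE ψ := by
  rw [sharplyCommute_iff]
  intro a z x w y _ h2 h3 h4
  rw [mem_zeroE] at h2 h3
  subst h2 h3
  rw [zero_sub, neg_mem_iff]
  exact AddSubgroup.mem_sup_right h4

theorem sharplyCommute_oneE : SharplyCommute oneE ψ := by
  rw [sharplyCommute_iff]
  intro a z x w y h1 h2 h3 h4
  rw [mem_oneE] at h2 h3
  subst h2 h3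
  exact AddSubgroup.mem_sup_right (sub_mem_kat h1 h4)

/-! ### Bikatakernels -/

variable {Γ Δ : Set (AddSubgroup (A × A))}

theorem kat_le_Kat (h : φ ∈ Γ) : kat φ ≤ Kat Γ := le_iSup₂_of_le φ h le_rfl

theorem Kat_mono (h : Γ ⊆ Δ) : Kat Γ ≤ Kat Δ := biSup_mono h

theorem biKat_comm : biKat Γ Δ = biKat Δ Γ := sup_comm _ _

theorem image_Kat_le (hφ : IsEndogeny φ) (h : ∀ ψ ∈ Γ, image φ (kat ψ) ≤ B) (hk : kat φ ≤ B) :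
    image φ (Kat Γ) ≤ B := by
  have key : Kat Γ ≤ (φ ⊓ B.comap (AddMonoidHom.snd A A)).map (AddMonoidHom.fst A A) := by
    refine iSup₂_le fun ψ hψ a ha => ?_
    obtain ⟨x, hx⟩ := hφ.1 a
    exact ⟨(a, x), ⟨hx, h ψ hψ ⟨a, ha, hx⟩⟩, rfl⟩
  rintro x ⟨a, ha, hx⟩
  obtain ⟨⟨a, y⟩, ⟨hy, hyB⟩, rfl⟩ := key ha
  rw [← sub_add_cancel x y]
  exact B.add_mem (hk (sub_mem_kat hx hy)) hyB

/-- Since `γ[kat γ'] = kat (γγ')` and `γ[kat δ] ≤ kat γ + kat δ`, the bikatakernel of two sharply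
commuting pre-rings is invariant. -/
theorem isInvariant_biKat_left (hΓ : IsPreRing Γ)
    (h : ∀ γ ∈ Γ, ∀ δ ∈ Δ, SharplyCommute γ δ) : IsInvariant Γ (biKat Γ Δ) := by
  intro γ hγ
  have hk : kat γ ≤ biKat Γ Δ := (kat_le_Kat hγ).trans le_sup_left
  have hγ' := hΓ.isEndogeny γ hγ
  rw [biKat, image_sup hγ']
  refine sup_le (image_Kat_le hγ' (fun ψ hψ => ?_) hk) (image_Kat_le hγ' (fun ψ hψ => ?_) hk)
  · exact (kat_le_Kat (hΓ.comp_mem γ hγ ψ hψ)).trans le_sup_left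
  · exact (h γ hγ ψ hψ).image_kat_le.trans (sup_le_sup (kat_le_Kat hγ) (kat_le_Kat hψ))

theorem isInvariant_biKat (hΓ : IsPreRing Γ) (hΔ : IsPreRing Δ)
    (h : ∀ γ ∈ Γ, ∀ δ ∈ Δ, SharplyCommute γ δ) : IsInvariant (Γ ∪ Δ) (biKat Γ Δ) := by
  rintro γ (hγ | hγ)
  · exact isInvariant_biKat_left hΓ h γ hγ
  · rw [biKat_comm]
    exact isInvariant_biKat_left hΔ (fun δ hδ γ hγ => (h γ hγ δ hδ).symm) γ hγ

theorem inducesEndomorphism (hφ : IsEndogeny φ) (hB : image φ B ≤ B) :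
    InducesEndomorphism φ B := by
  choose f hf using hφ.1
  have key : ∀ a b a' b', (a, b) ∈ φ → (a', b') ∈ φ → a - a' ∈ B → b - b' ∈ B :=
    fun a b a' b' h h' hB' => hB ⟨a - a', hB', by simpa using φ.sub_mem h h'⟩
  let g : A →+ A ⧸ B :=
    { toFun a := (f a : A ⧸ B)
      map_zero' := (QuotientAddGroup.eq_zero_iff _).2 (by
        simpa using key _ _ 0 0 (hf 0) φ.zero_mem (by simp))
      map_add' a b := by
        rw [← QuotientAddGroup.mk_add]
        refine QuotientAddGroup.eq_iff_sub_mem.2 ?_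
        exact key _ _ _ _ (hf (a + b)) (φ.add_mem (hf a) (hf b)) (by simp) }
  refine ⟨QuotientAddGroup.lift B g fun a ha => (QuotientAddGroup.eq_zero_iff _).2 (by
    simpa using key _ _ 0 0 (hf a) φ.zero_mem (by simpa using ha)), fun a b h => ?_⟩
  exact QuotientAddGroup.eq_iff_sub_mem.2 (key _ _ _ _ (hf a) h (by simp))

/-! ### Almost containment of subgroups -/

/-- `B` is almost contained in `C`: it is covered by finitely many translates of `C`. -/
def AlmostLe (B C : AddSubgroup A) : Prop :=
  ∃ F : Set A, F.Finite ∧ ∀ b ∈ B, ∃ f ∈ F, b - f ∈ C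

theorem almostLe_iff : AlmostLe B C ↔ C.relIndex B ≠ 0 := by
  constructor
  · rintro ⟨F, hF, h⟩
    choose f hf hfC using fun b : B => h b b.2
    have : Finite (B ⧸ C.addSubgroupOf B) := by
      have := hF.to_subtype
      refine Finite.of_injective
        (fun q : B ⧸ C.addSubgroupOf B => (⟨f q.out, hf _⟩ : F)) fun q q' hq => ?_
      have e : f q.out = f q'.out := congrArg Subtype.val hq
      rw [← q.out_eq', ← q'.out_eq']
      refine QuotientAddGroup.eq_iff_sub_mem.2 ?_
      rw [AddSubgroup.mem_addSubgroupOf]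
      have := C.sub_mem (hfC q.out) (hfC q'.out)
      rw [e] at this
      simpa using this
    exact AddSubgroup.index_ne_zero_of_finite
  · intro h
    have : Finite (B ⧸ C.addSubgroupOf B) :=
      
      AddSubgroup.finiteIndex_iff_finite_quotient.1 (⟨h⟩ : (C.addSubgroupOf B).FiniteIndex)
    refine ⟨Set.range fun q : B ⧸ C.addSubgroupOf B => (q.out : A), Set.finite_range _,
      fun b hb => ⟨_, ⟨(⟨b, hb⟩ : B), rfl⟩, ?_⟩⟩
    have := QuotientAddGroup.eq_iff_sub_mem.1
      (Quotient.out_eq' (QuotientAddGroup.mk (s := C.addSubgroupOf B) ⟨b, hb⟩)).symm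
    simpa [AddSubgroup.mem_addSubgroupOf] using this

namespace AlmostLe

theorem of_le (h : B ≤ C) : AlmostLe B C :=
  ⟨{0}, Set.finite_singleton _, fun b hb => ⟨0, rfl, by simpa using h hb⟩⟩

theorem of_finite (h : (B : Set A).Finite) : AlmostLe B C :=
  ⟨B, h, fun b hb => ⟨b, hb, by simp⟩⟩

theorem trans (h : AlmostLe B C) (h' : AlmostLe C D) : AlmostLe B D := by
  obtain ⟨F, hF, h⟩ := h
  obtain ⟨F', hF', h'⟩ := h'
  refine ⟨F + F', hF.add hF', fun b hb => ?_⟩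
  obtain ⟨f, hf, hc⟩ := h b hb
  obtain ⟨f', hf', hd⟩ := h' _ hc
  exact ⟨f + f', Set.add_mem_add hf hf', by rwa [← sub_sub]⟩

theorem sup (h : AlmostLe B D) (h' : AlmostLe C D) : AlmostLe (B ⊔ C) D := by
  obtain ⟨F, hF, h⟩ := h
  obtain ⟨F', hF', h'⟩ := h'
  refine ⟨F + F', hF.add hF', fun x hx => ?_⟩
  obtain ⟨b, hb, c, hc, rfl⟩ := AddSubgroup.mem_sup.1 hx
  obtain ⟨f, hf, hfD⟩ := h b hb
  obtain ⟨f', hf', hfD'⟩ := h' c hc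
  exact ⟨f + f', Set.add_mem_add hf hf', by
    simpa [add_sub_add_comm] using D.add_mem hfD hfD'⟩

theorem inf (h : AlmostLe B C) (h' : AlmostLe B D) : AlmostLe B (C ⊓ D) := by
  rw [almostLe_iff] at *
  exact AddSubgroup.relIndex_inf_ne_zero h h'

theorem finite (h : AlmostLe B C) (hC : (C : Set A).Finite) : (B : Set A).Finite := by
  obtain ⟨F, hF, h⟩ := h
  refine (hF.add hC).subset fun b hb => ?_
  obtain ⟨f, hf, hc⟩ := h b hb
  exact ⟨f, hf, _, hc, by simp⟩

theorem map (hφ : IsEndogeny φ) (h : AlmostLe B C) : AlmostLe (image φ B) (image φ C) := by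
  obtain ⟨F, hF, h⟩ := h
  choose g hg using hφ.1
  refine ⟨g '' F, hF.image g, ?_⟩
  rintro x ⟨b, hb, hx⟩
  obtain ⟨f, hf, hc⟩ := h b hb
  exact ⟨g f, ⟨f, hf, rfl⟩, b - f, hc, by simpa using φ.sub_mem hx (hg f)⟩

theorem finset_sup {ι : Type*} {s : Finset ι} {f : ι → AddSubgroup A}
    (h : ∀ i ∈ s, AlmostLe (f i) C) : AlmostLe (s.sup f) C :=
  Finset.sup_induction (p := fun B => AlmostLe B C) (.of_le bot_le) (fun _ h _ h' => h.sup h') h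

/-- If `φ[f i]` is almost contained in `C` for all `i`, then `φ` maps the sum of the `f i` almost
into `C`. -/
theorem image_finset_sup {ι : Type*} {s : Finset ι}
    {f : ι → AddSubgroup A} (hφ : IsEndogeny φ) (h : ∀ i ∈ s, AlmostLe (image φ (f i)) C) :
    AlmostLe (image φ (s.sup f)) C := by
  refine Finset.sup_induction (p := fun B => AlmostLe (image φ B) C) ?_ (fun B hB B' hB' => ?_) h
  · exact .of_finite (finite_image hφ (by simp))
  · rw [image_sup hφ]
    exact hB.sup hB'

end AlmostLe

theorem isAlmostInvariant_iff : IsAlmostInvariant Γ B ↔ ∀ γ ∈ Γ, AlmostLe (image γ B) B :=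
  forall₂_congr fun _ _ => almostLe_iff.symm

theorem IsAlmostInvariant.inf (hB : IsAlmostInvariant Γ B) (hC : IsAlmostInvariant Γ C) :
    IsAlmostInvariant Γ (B ⊓ C) := by
  rw [isAlmostInvariant_iff] at *
  exact fun γ hγ => ((AlmostLe.of_le (image_mono inf_le_left)).trans (hB γ hγ)).inf
    ((AlmostLe.of_le (image_mono inf_le_right)).trans (hC γ hγ))

theorem IsAlmostInvariant.top : IsAlmostInvariant Γ (⊤ : AddSubgroup A) :=
  isAlmostInvariant_iff.2 fun _ _ => AlmostLe.of_le le_top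

/-- If `φ` and `ψ` sharply commute, then `φ` almost preserves the kernel of `ψ`: it maps this kernel
to elements with `ψ`-values in the finite group `kat φ + kat ψ`. -/
theorem SharplyCommute.image_ker_almostLe (hφ : IsEndogeny φ) (hψ : IsEndogeny ψ)
    (h : SharplyCommute φ ψ) : AlmostLe (image φ (ker ψ)) (ker ψ) := by
  classical
  let g : A → A := fun y => if hy : ∃ x, (x, y) ∈ ψ then hy.choose else 0
  refine ⟨g '' (kat φ ⊔ kat ψ : AddSubgroup A), (finite_sup hφ.2 hψ.2).image g, ?_⟩
  rintro x ⟨a, ha, hx⟩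
  obtain ⟨y, hy⟩ := hψ.1 x
  have hy' : y ∈ kat φ ⊔ kat ψ := by
    have := sharplyCommute_iff.1 h a 0 0 x y ha φ.zero_mem hx hy
    simpa using this
  have hex : ∃ x, (x, y) ∈ ψ := ⟨x, hy⟩
  have hg : (g y, y) ∈ ψ := by
    simp only [g, dif_pos hex]
    exact hex.choose_spec
  exact ⟨g y, ⟨y, hy', rfl⟩, by simpa [mem_ker] using ψ.sub_mem hy hg⟩

/-- The image `φ[B]` is finite if and only if the kernel of `φ` has finite index in `B`. -/
theorem finite_image_iff (hφ : IsEndogeny φ) :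
    (image φ B : Set A).Finite ↔ AlmostLe B (ker φ) := by
  classical
  constructor
  · intro h
    let g : A → A := fun y => if hy : ∃ x, (x, y) ∈ φ then hy.choose else 0
    refine ⟨g '' image φ B, h.image g, fun b hb => ?_⟩
    obtain ⟨y, hy⟩ := hφ.1 b
    have hex : ∃ x, (x, y) ∈ φ := ⟨b, hy⟩
    have hg : (g y, y) ∈ φ := by
      simp only [g, dif_pos hex]
      exact hex.choose_spec
    exact ⟨g y, ⟨y, ⟨b, hb, hy⟩, rfl⟩, by simpa [mem_ker] using φ.sub_mem hy hg⟩
  · intro h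
    refine (h.map hφ).finite ?_
    refine hφ.2.subset ?_
    rintro x ⟨a, ha, hx⟩
    simpa using sub_mem_kat hx ha

end Relations

/-! ### Large families of pairwise inequivalent relations -/

section Large

/-- Either a relation admits arbitrarily long sequences of pairwise unrelated elements of `S`, or
`S` has a finite net. -/
theorem exists_pairwise_or_finite_net {α : Type*} (S : Set α) (r : α → α → Prop) :
    (∀ m : ℕ, ∃ f : Fin m → α, (∀ i, f i ∈ S) ∧ ∀ i j, i ≠ j → ¬ r (f i) (f j)) ∨
      ∃ R ⊆ S, R.Finite ∧ ∀ a ∈ S, a ∈ R ∨ ∃ b ∈ R, r a b ∨ r b a := by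
  by_contra! h
  obtain ⟨⟨m, hm⟩, h⟩ := h
  suffices ∀ k : ℕ, ∃ f : Fin k → α, (∀ i, f i ∈ S) ∧ ∀ i j, i ≠ j → ¬ r (f i) (f j) by
    obtain ⟨f, hf, hr⟩ := this m
    obtain ⟨i, j, hij, h'⟩ := hm f hf
    exact hr i j hij h'
  intro k
  induction k with
  | zero => exact ⟨Fin.elim0, fun i => i.elim0, fun i => i.elim0⟩
  | succ k ih =>
    obtain ⟨f, hf, hr⟩ := ih
    obtain ⟨a, ha, -, hb⟩ := h (Set.range f) (Set.range_subset_iff.2 hf) (Set.finite_range f)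
    refine ⟨Fin.cons a f, fun i => ?_, fun i j hij => ?_⟩
    · induction i using Fin.cases <;> simp [ha, hf]
    · induction i using Fin.cases with
      | zero =>
        induction j using Fin.cases with
        | zero => exact absurd rfl hij
        | succ j => simpa using (hb (f j) ⟨j, rfl⟩).1
      | succ i =>
        induction j using Fin.cases with
        | zero => simpa using (hb (f i) ⟨i, rfl⟩).2
        | succ j => simpa using hr i j fun e => hij (congrArg Fin.succ e)

variable {A : Type u} [AddCommGroup A] {φ ψ χ : AddSubgroup (A × A)} {B C : AddSubgroup A}
  {Γ Δ : Set (AddSubgroup (A × A))}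

/-- The relations `φ` and `ψ` are equivalent on `B`: the image `(φ - ψ)[B]` is finite. -/
def EquivalentOn (B : AddSubgroup A) (φ ψ : AddSubgroup (A × A)) : Prop :=
  (image (subE φ ψ) B : Set A).Finite

theorem EquivalentOn.refl (hφ : IsEndogeny φ) : EquivalentOn B φ φ := by
  refine hφ.2.subset ?_
  rintro x ⟨a, -, h⟩
  obtain ⟨x, y, hx, hy, rfl⟩ := mem_subE.1 h
  exact sub_mem_kat hx hy

theorem EquivalentOn.symm (h : EquivalentOn B φ ψ) : EquivalentOn B ψ φ := by
  refine h.subset ?_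
  rintro x ⟨a, ha, h⟩
  obtain ⟨x, y, hx, hy, rfl⟩ := mem_subE.1 h
  rw [SetLike.mem_coe, ← neg_mem_iff, neg_sub]
  exact ⟨a, ha, mem_subE.2 ⟨y, x, hy, hx, rfl⟩⟩

theorem EquivalentOn.trans (hψ : IsEndogeny ψ) (h : EquivalentOn B φ ψ)
    (h' : EquivalentOn B ψ χ) : EquivalentOn B φ χ := by
  refine (h.add h').subset ?_
  rintro x ⟨a, ha, h⟩
  obtain ⟨x, y, hx, hy, rfl⟩ := mem_subE.1 h
  obtain ⟨w, hw⟩ := hψ.1 a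
  exact ⟨x - w, ⟨a, ha, mem_subE.2 ⟨x, w, hx, hw, rfl⟩⟩, w - y,
    ⟨a, ha, mem_subE.2 ⟨w, y, hw, hy, rfl⟩⟩, by simp⟩

/-- `Γ` contains arbitrarily many relations that are pairwise inequivalent on `B`. -/
def HasManyOn (Γ : Set (AddSubgroup (A × A))) (B : AddSubgroup A) : Prop :=
  ∀ m : ℕ, ∃ f : Fin m → AddSubgroup (A × A), (∀ i, f i ∈ Γ) ∧
    ∀ i j, i ≠ j → ¬ EquivalentOn B (f i) (f j)

theorem HasManyOn.mono (h : HasManyOn Γ B) (hΓ : Γ ⊆ Δ) : HasManyOn Δ B := fun m =>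
  let ⟨f, hf, hr⟩ := h m
  ⟨f, fun i => hΓ (hf i), hr⟩

theorem EssentiallyInfinite.hasManyOn (h : EssentiallyInfinite Γ) : HasManyOn Γ ⊤ := by
  intro m
  have : Infinite (EssQuot Γ) := h
  let e : ℕ ↪ EssQuot Γ := Infinite.natEmbedding _
  refine ⟨fun i => (e i).out.1, fun i => (e i).out.2, fun i j hij he => hij ?_⟩
  apply Fin.ext
  apply e.injective
  rw [← (e i).out_eq, ← (e j).out_eq]
  exact Quot.sound he

end Large

/-! ### Minimal pairs of pre-rings in the presence of a dimension -/

section Dimension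

variable {A : Type u} [AddCommGroup A] {B C : AddSubgroup A} {γ : AddSubgroup (A × A)}
  {Γ Δ : Set (AddSubgroup (A × A))}

/-- A lattice of subgroups of `A` with an integer-valued dimension that is monotone, and strictly
monotone for subgroups of infinite index. -/
structure DimensionLattice (A : Type u) [AddCommGroup A] where
  /-- the subgroups in the lattice -/
  carrier : Set (AddSubgroup A)
  /-- the dimension; only its values on the lattice matter -/
  dim : AddSubgroup A → ℕ
  top_mem : ⊤ ∈ carrier
  inf_mem : ∀ {B C}, B ∈ carrier → C ∈ carrier → B ⊓ C ∈ carrier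
  sup_mem : ∀ {B C}, B ∈ carrier → C ∈ carrier → B ⊔ C ∈ carrier
  dim_mono : ∀ {B C}, B ∈ carrier → C ∈ carrier → B ≤ C → dim B ≤ dim C
  dim_lt : ∀ {B C}, B ∈ carrier → C ∈ carrier → B ≤ C → ¬ AlmostLe C B → dim B < dim C

/-- The relation `γ` is compatible with a lattice of subgroups: the lattice contains its kernel and
is closed under images by `γ`. -/
structure DimensionLattice.Compatible (D : DimensionLattice A) (γ : AddSubgroup (A × A)) :
    Prop where
  ker_mem : ker γ ∈ D.carrier
  image_mem : ∀ B ∈ D.carrier, image γ B ∈ D.carrier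

/-- Two sharply commuting pre-rings of endogenies that are compatible with a lattice of subgroups
for which `A` is absolutely minimal. -/
structure IsMinimalPair (D : DimensionLattice A) (Γ Δ : Set (AddSubgroup (A × A))) : Prop where
  left : IsPreRing Γ
  right : IsPreRing Δ
  comm : ∀ γ ∈ Γ, ∀ δ ∈ Δ, SharplyCommute γ δ
  compatible_left : ∀ γ ∈ Γ, D.Compatible γ
  compatible_right : ∀ δ ∈ Δ, D.Compatible δ
  minimal : ∀ B ∈ D.carrier, (B : Set A).Infinite → IsAlmostInvariant (Γ ∪ Δ) B → B.index ≠ 0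

variable {D : DimensionLattice A}

namespace IsMinimalPair

theorem symm (h : IsMinimalPair D Γ Δ) : IsMinimalPair D Δ Γ where
  left := h.right
  right := h.left
  comm δ hδ γ hγ := (h.comm γ hγ δ hδ).symm
  compatible_left := h.compatible_right
  compatible_right := h.compatible_left
  minimal B hB hi hB' := h.minimal B hB hi (by rwa [Set.union_comm])

theorem isAlmostInvariant_ker_inf (h : IsMinimalPair D Γ Δ) (hγ : γ ∈ Γ)
    (hB : IsAlmostInvariant Δ B) : IsAlmostInvariant Δ (ker γ ⊓ B) := by
  refine IsAlmostInvariant.inf (isAlmostInvariant_iff.2 fun δ hδ => ?_) hB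
  exact (h.comm γ hγ δ hδ).symm.image_ker_almostLe (h.right.isEndogeny δ hδ)
    (h.left.isEndogeny γ hγ)

theorem dim_ker_inf_lt (h : IsMinimalPair D Γ Δ) (hγ : γ ∈ Γ) (hB : B ∈ D.carrier)
    (hi : ¬ (image γ B : Set A).Finite) : D.dim (ker γ ⊓ B) < D.dim B := by
  refine D.dim_lt (D.inf_mem (h.compatible_left γ hγ).ker_mem hB) hB inf_le_right fun hle => hi ?_
  exact (finite_image_iff (h.left.isEndogeny γ hγ)).2 (hle.trans (.of_le inf_le_left))

/-- The `Γ`-translates of an infinite almost `Δ`-invariant subgroup generate `A` up to finite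
index; since the dimension is bounded, finitely many of them suffice. -/
theorem exists_almostLe_sup_image (h : IsMinimalPair D Γ Δ) (hB : B ∈ D.carrier)
    (hi : (B : Set A).Infinite) (hinv : IsAlmostInvariant Δ B) :
    ∃ s : Finset (AddSubgroup (A × A)), ↑s ⊆ Γ ∧ AlmostLe ⊤ (s.sup fun σ => image σ B) := by
  classical
  let S : Finset (AddSubgroup (A × A)) → AddSubgroup A := fun s => s.sup fun σ => image σ B
  have hS : ∀ s : Finset (AddSubgroup (A × A)), ↑s ⊆ Γ → oneE ∈ s → S s ∈ D.carrier := by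
    intro s hs h1
    rw [show S s = _ from (Finset.sup'_eq_sup ⟨oneE, h1⟩ fun σ => image σ B).symm]
    exact Finset.sup'_induction ⟨oneE, h1⟩ _ (p := (· ∈ D.carrier))
      (fun _ h _ h' => D.sup_mem h h') fun σ hσ => (h.compatible_left σ (hs hσ)).image_mem B hB
  -- a sum of maximal dimension
  obtain ⟨s, hs, h1, hmax⟩ : ∃ s : Finset (AddSubgroup (A × A)), ↑s ⊆ Γ ∧ oneE ∈ s ∧
      ∀ t : Finset (AddSubgroup (A × A)), ↑t ⊆ Γ → oneE ∈ t → D.dim (S t) ≤ D.dim (S s) := by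
    by_contra! hno
    have hunb : ∀ k : ℕ, ∃ s : Finset (AddSubgroup (A × A)), ↑s ⊆ Γ ∧ oneE ∈ s ∧
        k ≤ D.dim (S s) := by
      intro k
      induction k with
      | zero => exact ⟨{oneE}, by simpa using h.left.one_mem, by simp, Nat.zero_le _⟩
      | succ k ih =>
        obtain ⟨s, hs, h1, hk⟩ := ih
        obtain ⟨t, ht, h1', hlt⟩ := hno s hs h1
        exact ⟨t, ht, h1', by omega⟩
    obtain ⟨s, hs, h1, hk⟩ := hunb (D.dim ⊤ + 1)
    have := D.dim_mono (hS s hs h1) D.top_mem le_top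
    omega
  have hle : ∀ σ ∈ Γ, AlmostLe (image σ B) (S s) := by
    intro σ hσ
    have ht : ↑(insert σ s) ⊆ Γ := by
      rw [Finset.coe_insert]
      exact Set.insert_subset hσ hs
    have h1' : oneE ∈ insert σ s := Finset.mem_insert_of_mem h1
    have hsub : S s ≤ S (insert σ s) := Finset.sup_mono (Finset.subset_insert _ _)
    have : AlmostLe (S (insert σ s)) (S s) := by
      by_contra hno
      have := D.dim_lt (hS s hs h1) (hS _ ht h1') hsub hno
      have := hmax _ ht h1'
      omega
    exact (AlmostLe.of_le
      (Finset.le_sup (f := fun σ => image σ B) (Finset.mem_insert_self σ s))).trans this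
  have hBS : B ≤ S s := by
    refine le_trans ?_ (Finset.le_sup (f := fun σ => image σ B) h1)
    exact fun b hb => ⟨b, hb, mem_oneE.2 rfl⟩
  refine ⟨s, hs, ?_⟩
  rw [almostLe_iff, AddSubgroup.relIndex_top_right]
  refine h.minimal _ (hS s hs h1) (hi.mono hBS) (isAlmostInvariant_iff.2 ?_)
  rintro γ (hγ | hγ)
  · refine AlmostLe.image_finset_sup (h.left.isEndogeny γ hγ) fun σ hσ => ?_
    rw [← image_compE]
    exact hle _ (h.left.comp_mem γ hγ σ (hs hσ))
  · refine AlmostLe.image_finset_sup (h.right.isEndogeny γ hγ) fun σ hσ => ?_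
    -- `γ[σ[B]]` lies in `σ[γ[B]]` up to katakernels, and `γ[B] ≲ B`
    have hσE := h.left.isEndogeny σ (hs hσ)
    have hγE := h.right.isEndogeny γ hγ
    have hc := sharplyCommute_iff.1 (h.comm σ (hs hσ) γ hγ)
    have hsub : image γ (image σ B) ≤ image σ (image γ B) ⊔ (kat σ ⊔ kat γ) := by
      rintro x ⟨w, ⟨b, hb, hw⟩, hx⟩
      obtain ⟨z, hz⟩ := hγE.1 b
      obtain ⟨y, hy⟩ := hσE.1 z
      refine AddSubgroup.mem_sup.2 ⟨y, ⟨z, ⟨b, hb, hz⟩, hy⟩, x - y, ?_, by simp⟩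
      rw [← neg_mem_iff, neg_sub]
      exact hc b z y w x hz hy hw hx
    refine (AlmostLe.of_le hsub).trans (.sup ?_ (.of_finite (finite_sup hσE.2 hγE.2)))
    exact ((isAlmostInvariant_iff.1 hinv γ hγ).map hσE).trans
      (.of_le (Finset.le_sup (f := fun σ => image σ B) hσ))

/-- If `Γ` has many inequivalent elements, it has many inequivalent elements on every infinite
almost `Δ`-invariant subgroup `B`: an element `γ` is determined, up to equivalence, by the
restrictions to `B` of finitely many products `γσ`. -/
theorem hasManyOn (h : IsMinimalPair D Γ Δ) (hm : HasManyOn Γ ⊤) (hB : B ∈ D.carrier)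
    (hi : (B : Set A).Infinite) (hinv : IsAlmostInvariant Δ B) : HasManyOn Γ B := by
  obtain ⟨s, hs, hle⟩ := h.exists_almostLe_sup_image hB hi hinv
  refine (exists_pairwise_or_finite_net Γ (EquivalentOn B)).resolve_right ?_
  rintro ⟨R, hRΓ, hR, hnet⟩
  have hnet' : ∀ γ ∈ Γ, ∃ ρ : R, EquivalentOn B γ ρ := by
    intro γ hγ
    rcases hnet γ hγ with hγR | ⟨ρ, hρ, hr | hr⟩
    · exact ⟨⟨γ, hγR⟩, .refl (h.left.isEndogeny γ hγ)⟩
    · exact ⟨⟨ρ, hρ⟩, hr⟩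
    · exact ⟨⟨ρ, hρ⟩, hr.symm⟩
  choose c hc using fun γ : Γ => fun σ : s =>
    hnet' (compE γ.1 σ.1) (h.left.comp_mem _ γ.2 _ (hs σ.2))
  have : Finite R := hR
  obtain ⟨k, ⟨e⟩⟩ := Finite.exists_equiv_fin (s → R)
  obtain ⟨f, hf, hr⟩ := hm (k + 1)
  obtain ⟨i, j, hij, hcij⟩ := Fintype.exists_ne_map_eq_of_card_lt
    (fun i : Fin (k + 1) => e (c ⟨f i, hf i⟩)) (by simp)
  have hcij := e.injective hcij
  have hiE := h.left.isEndogeny _ (hf i)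
  have hjE := h.left.isEndogeny _ (hf j)
  refine hr i j hij ((finite_image_iff (hiE.subE hjE)).2 (hle.trans ?_))
  refine AlmostLe.finset_sup fun σ hσ => (finite_image_iff (hiE.subE hjE)).1 ?_
  have h1 := hc ⟨f i, hf i⟩ ⟨σ, hσ⟩
  have h2 := hc ⟨f j, hf j⟩ ⟨σ, hσ⟩
  rw [hcij] at h1
  refine (EquivalentOn.trans (h.left.isEndogeny _ (hRΓ (c _ _).2)) h1 h2.symm).subset ?_
  rintro x ⟨a, ⟨b, hb, ha⟩, hx⟩
  obtain ⟨y, z, hy, hz, rfl⟩ := mem_subE.1 hx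
  exact ⟨b, hb, mem_subE.2 ⟨y, z, ⟨a, ha, hy⟩, ⟨a, ha, hz⟩, rfl⟩⟩

/-- The katakernels of bounded size have finite union. Given more than `N` elements `δ` of `Δ`, an
element `x` of a group `kat γ` with at most `N` elements lies in the kernel of a difference of two
of them, because `δ[x] ≤ kat γ + kat δ`; this leads to almost `Γ`-invariant subgroups of smaller
dimension. -/
theorem finite_kat_of_card_le (h : IsMinimalPair D Γ Δ) (hm : HasManyOn Δ ⊤) (N : ℕ) :
    ∀ B ∈ D.carrier, IsAlmostInvariant Γ B →
      {x ∈ B | ∃ γ ∈ Γ, x ∈ kat γ ∧ (kat γ : Set A).ncard ≤ N}.Finite := by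
  suffices ∀ d : ℕ, ∀ B ∈ D.carrier, D.dim B = d → IsAlmostInvariant Γ B →
      {x ∈ B | ∃ γ ∈ Γ, x ∈ kat γ ∧ (kat γ : Set A).ncard ≤ N}.Finite from
    fun B hB => this _ B hB rfl
  intro d
  induction d using Nat.strong_induction_on with | _ d ih
  rintro B hB rfl hinv
  by_cases hfin : (B : Set A).Finite
  · exact hfin.subset fun x hx => hx.1
  obtain ⟨f, hf, hr⟩ := h.symm.hasManyOn hm hB hfin hinv (N + 1)
  refine Set.Finite.subset (s := ⋃ p : {p : Fin (N + 1) × Fin (N + 1) // p.1 ≠ p.2},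
    {x ∈ ker (subE (f p.1.1) (f p.1.2)) ⊓ B |
      ∃ γ ∈ Γ, x ∈ kat γ ∧ (kat γ : Set A).ncard ≤ N}) ?_ ?_
  · refine Set.finite_iUnion fun p => ?_
    have hp := h.right.sub_mem (hf p.1.1) (hf p.1.2)
    exact ih _ (h.symm.dim_ker_inf_lt hp hB (hr _ _ p.2)) _
      (D.inf_mem (h.compatible_right _ hp).ker_mem hB) rfl
      (h.symm.isAlmostInvariant_ker_inf hp hinv)
  · rintro x ⟨hxB, γ, hγ, hx, hN⟩
    have hex : ∀ i, ∃ y ∈ kat γ, (x, y) ∈ f i := by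
      intro i
      obtain ⟨z, hz⟩ := (h.right.isEndogeny _ (hf i)).1 x
      obtain ⟨y, hy, w, hw, rfl⟩ := AddSubgroup.mem_sup.1
        ((h.comm γ hγ _ (hf i)).symm.image_kat_le ⟨x, hx, hz⟩)
      exact ⟨w, hw, by simpa using (f i).sub_mem hz hy⟩
    choose g hg hgf using hex
    have hkat := (h.left.isEndogeny γ hγ).2
    have hg' : ∀ i ∈ Finset.univ, g i ∈ hkat.toFinset := fun i _ => hkat.mem_toFinset.2 (hg i)
    obtain ⟨i, -, j, -, hij, he⟩ := Finset.exists_ne_map_eq_of_card_lt_of_maps_to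
      (by rw [← Set.ncard_eq_toFinset_card _ hkat]; simpa using Nat.lt_succ_of_le hN) hg'
    refine Set.mem_iUnion.2 ⟨⟨(i, j), hij⟩, ⟨?_, hxB⟩, γ, hγ, hx, hN⟩
    exact mem_subE.2 ⟨g i, g j, hgf i, hgf j, by rw [he, sub_self]⟩

end IsMinimalPair

/-- Because `kat γ + kat γ' = kat (γ + γ')`, the global katakernel of a pre-ring is the union of the
katakernels. -/
theorem IsPreRing.mem_Kat (hΓ : IsPreRing Γ) {x : A} : x ∈ Kat Γ ↔ ∃ γ ∈ Γ, x ∈ kat γ := by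
  refine AddSubgroup.mem_biSup_of_directedOn hΓ.zero_mem fun γ hγ γ' hγ' => ?_
  refine ⟨_, hΓ.add_mem γ hγ γ' hγ', ?_, ?_⟩ <;> simp only [Function.onFun, kat_addE]
  · exact le_sup_left
  · exact le_sup_right

namespace IsMinimalPair

theorem countable_Kat (h : IsMinimalPair D Γ Δ) (hm : HasManyOn Δ ⊤) :
    (Kat Γ : Set A).Countable := by
  refine Set.Countable.mono (s₂ := ⋃ N : ℕ,
    {x ∈ (⊤ : AddSubgroup A) | ∃ γ ∈ Γ, x ∈ kat γ ∧ (kat γ : Set A).ncard ≤ N}) ?_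
    (Set.countable_iUnion fun N => (h.finite_kat_of_card_le hm N ⊤ D.top_mem .top).countable)
  intro x hx
  obtain ⟨γ, hγ, hx⟩ := h.left.mem_Kat.1 hx
  exact Set.mem_iUnion.2 ⟨_, trivial, γ, hγ, hx, le_rfl⟩

theorem countable_biKat (h : IsMinimalPair D Γ Δ) (hΓ : HasManyOn Γ ⊤) (hΔ : HasManyOn Δ ⊤) :
    (biKat Γ Δ : Set A).Countable := by
  refine Set.Countable.mono (s₂ := (Kat Γ : Set A) + Kat Δ) (fun x hx => ?_)
    ((h.countable_Kat hΔ).image2 (h.symm.countable_Kat hΓ) _)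
  obtain ⟨y, hy, z, hz, h⟩ := AddSubgroup.mem_sup.1 hx
  exact ⟨y, hy, z, hz, h⟩

/-- A `Γ`-invariant subgroup `Y` that is killed by an element of `Γ` with infinite image is finite:
the annihilator of `Y` in `Γ` is a two-sided ideal, so that on every infinite almost `Δ`-invariant
subgroup `B` it has an element with infinite image; the kernel of this element in `B` contains
`Y ∩ B` and has smaller dimension than `B`. -/
theorem finite_of_le_ker (h : IsMinimalPair D Γ Δ) {Y : AddSubgroup A} (hY : IsInvariant Γ Y)
    (hγ : γ ∈ Γ) (hi : ¬ (image γ ⊤ : Set A).Finite) (hYγ : Y ≤ ker γ) : (Y : Set A).Finite := by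
  suffices ∀ d : ℕ, ∀ B ∈ D.carrier, D.dim B = d → IsAlmostInvariant Δ B →
      ((Y ⊓ B : AddSubgroup A) : Set A).Finite by
    simpa using this _ ⊤ D.top_mem rfl .top
  intro d
  induction d using Nat.strong_induction_on with | _ d ih
  rintro B hB rfl hinv
  by_cases hfin : (B : Set A).Finite
  · exact hfin.subset fun x hx => hx.2
  obtain ⟨s, hs, hle⟩ := h.exists_almostLe_sup_image hB hfin hinv
  have hγE := h.left.isEndogeny γ hγ
  obtain ⟨σ, hσ, hσi⟩ : ∃ σ ∈ s, ¬ (image γ (image σ B) : Set A).Finite := by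
    by_contra! hno
    exact hi ((finite_image_iff hγE).2
      (hle.trans (AlmostLe.finset_sup fun σ hσ => (finite_image_iff hγE).1 (hno σ hσ))))
  rw [← image_compE] at hσi
  have hγσ := h.left.comp_mem γ hγ σ (hs hσ)
  refine (ih _ (h.dim_ker_inf_lt hγσ hB hσi) _
    (D.inf_mem (h.compatible_left _ hγσ).ker_mem hB) rfl
    (h.isAlmostInvariant_ker_inf hγσ hinv)).subset ?_
  rintro y ⟨hy, hyB⟩
  obtain ⟨z, hz⟩ := (h.left.isEndogeny σ (hs hσ)).1 y
  exact ⟨hy, ⟨z, hz, hYγ (hY σ (hs hσ) ⟨y, hy, hz⟩)⟩, hyB⟩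

end IsMinimalPair

end Dimension

/-! ### Definable relations on a definable group -/

namespace DefAbGroup

variable {L : FirstOrder.Language.{u, u}} {M : Type u} [L.Structure M] {C : Set M} {n : ℕ}

theorem definable_setOf_realize {α β : Type*} (φ : L.Formula (β ⊕ α)) (w : β → M) :
    (Set.univ : Set M).Definable L {v : α → M | φ.Realize (Sum.elim w v)} := by
  refine Set.definable_iff_exists_formula_sum.2
    ⟨φ.relabel (Sum.map (fun b => (⟨w b, trivial⟩ : ↥(Set.univ : Set M))) id), ?_⟩
  ext v
  simp only [Set.mem_ofPred_eq, Formula.realize_relabel]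
  have : Sum.elim (fun b : ↥(Set.univ : Set M) => b.1) v ∘
      Sum.map (fun b => ⟨w b, trivial⟩) id = Sum.elim w v := by
    ext x
    cases x <;> rfl
  rw [this]

/-- The tuple of coordinates of a tuple of elements of the group. -/
def coords (G : DefAbGroup L C n) {ι : Type*} (g : ι → G.Carrier) : ι × Fin n → M :=
  fun p => (g p.1).1 p.2

/-- A relation on a definable group, in variables indexed by `ι`, is definable with parameters. -/
def DefRel (G : DefAbGroup L C n) {ι : Type*} (S : Set (ι → G.Carrier)) : Prop :=
  (Set.univ : Set M).Definable L (G.coords '' S)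

variable {G : DefAbGroup L C n} {ι κ : Type*}

theorem coords_injective : Function.Injective (G.coords (ι := ι)) := fun _ _ h =>
  funext fun i => Subtype.ext (funext fun j => congrFun h (i, j))

namespace DefRel

theorem univ [Finite ι] : G.DefRel (Set.univ : Set (ι → G.Carrier)) := by
  have : G.coords '' (Set.univ : Set (ι → G.Carrier)) = ⋂ i : ι, (fun v : ι × Fin n → M =>
      v ∘ fun j => (i, j)) ⁻¹' {x | G.dom.Realize (Sum.elim Subtype.val x)} := by
    ext v
    simp only [Set.image_univ, Set.mem_range, Set.mem_iInter, Set.mem_preimage, Set.mem_ofPred_eq]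
    constructor
    · rintro ⟨g, rfl⟩ i
      exact (g i).2
    · intro h
      exact ⟨fun i => ⟨_, h i⟩, rfl⟩
  rw [DefRel, this]
  exact Set.definable_iInter_of_finite fun i => (definable_setOf_realize _ _).preimage_comp _

theorem and {P Q : (ι → G.Carrier) → Prop} (hP : G.DefRel {g | P g}) (hQ : G.DefRel {g | Q g}) :
    G.DefRel {g | P g ∧ Q g} := by
  have := Set.Definable.inter hP hQ
  rwa [← Set.image_inter coords_injective] at this

theorem reindex [Finite κ] {P : (ι → G.Carrier) → Prop} (hP : G.DefRel {g | P g}) (f : ι → κ) :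
    G.DefRel {g : κ → G.Carrier | P (g ∘ f)} := by
  have : G.coords '' {g : κ → G.Carrier | P (g ∘ f)} = G.coords '' Set.univ ∩
      (fun v : κ × Fin n → M => v ∘ Prod.map f id) ⁻¹' (G.coords '' {g | P g}) := by
    ext v
    constructor
    · rintro ⟨g, hg, rfl⟩
      exact ⟨⟨g, trivial, rfl⟩, g ∘ f, hg, rfl⟩
    · rintro ⟨⟨g, -, rfl⟩, g', hg', h⟩
      have : g' = g ∘ f := coords_injective h
      exact ⟨g, by rwa [this] at hg', rfl⟩
  rw [DefRel, this]
  exact univ.inter (Set.Definable.preimage_comp _ hP)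

theorem ex [Finite ι] {P : G.Carrier → (ι → G.Carrier) → Prop}
    (hP : G.DefRel {g : Option ι → G.Carrier | P (g none) (g ∘ some)}) :
    G.DefRel {g | ∃ x, P x g} := by
  have : G.coords '' {g : ι → G.Carrier | ∃ x, P x g} =
      (fun v : Option ι × Fin n → M => v ∘ Prod.map some id) ''
        (G.coords '' {g : Option ι → G.Carrier | P (g none) (g ∘ some)}) := by
    ext v
    constructor
    · rintro ⟨g, ⟨x, hx⟩, rfl⟩
      exact ⟨_, ⟨fun i => i.elim x g, hx, rfl⟩, rfl⟩
    · rintro ⟨_, ⟨g, hg, rfl⟩, rfl⟩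
      exact ⟨g ∘ some, ⟨g none, hg⟩, rfl⟩
  rw [DefRel, this]
  exact Set.Definable.image_comp hP _

theorem of_formula [Finite ι] {β : Type*} (φ : L.Formula (β ⊕ (ι × Fin n))) (w : β → M) :
    G.DefRel {g : ι → G.Carrier | φ.Realize (Sum.elim w (G.coords g))} := by
  have : G.coords '' {g : ι → G.Carrier | φ.Realize (Sum.elim w (G.coords g))} =
      G.coords '' Set.univ ∩ {v | φ.Realize (Sum.elim w v)} := by
    ext v
    constructor
    · rintro ⟨g, hg, rfl⟩
      exact ⟨⟨g, trivial, rfl⟩, hg⟩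
    · rintro ⟨⟨g, -, rfl⟩, hg⟩
      exact ⟨g, hg, rfl⟩
  rw [DefRel, this]
  exact univ.inter (definable_setOf_realize _ _)

theorem add [Finite ι] (i j k : ι) : G.DefRel {g : ι → G.Carrier | g i + g j = g k} := by
  convert of_formula (G := G) (ι := ι) (G.add.relabel (Sum.map id (Sum.elim (fun t => (i, t))
    (Sum.elim (fun t => (j, t)) fun t => (k, t))))) Subtype.val using 1
  ext g
  rw [Set.mem_ofPred_eq, Set.mem_ofPred_eq, Formula.realize_relabel, ← G.add_iff]
  apply iff_of_eq
  congr 1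
  ext x
  rcases x with x | x | x | x <;> rfl

theorem eq_const [Finite ι] (i : ι) (c : G.Carrier) : G.DefRel {g : ι → G.Carrier | g i = c} := by
  have : G.coords '' {g : ι → G.Carrier | g i = c} = G.coords '' Set.univ ∩
      ⋂ j : Fin n, (fun v : ι × Fin n → M => v ∘ fun _ : Fin 1 => (i, j)) ⁻¹'
        {x | x 0 ∈ ({c.1 j} : Set M)} := by
    ext v
    constructor
    · rintro ⟨g, rfl, rfl⟩
      exact ⟨⟨g, trivial, rfl⟩, Set.mem_iInter.2 fun j => rfl⟩
    · rintro ⟨⟨g, -, rfl⟩, hg⟩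
      exact ⟨g, Subtype.ext (funext fun j => Set.mem_iInter.1 hg j), rfl⟩
  rw [DefRel, this]
  exact univ.inter (Set.definable_iInter_of_finite fun j =>
    Set.Definable.preimage_comp _ (Set.Definable.singleton_of_mem L (Set.mem_univ _)))

theorem eq [Finite ι] (i j : ι) : G.DefRel {g : ι → G.Carrier | g i = g j} := by
  have h : G.DefRel {g : ι → G.Carrier | ∃ z, z = 0 ∧ z + g i = g j} :=
    .ex (.and (eq_const none 0) (add none (some i) (some j)))
  simpa using h

/-- A definable relation between pairs of elements of the group, as a definable relation between
`n`-tuples. -/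
theorem definable_pairs (P : G.Carrier → G.Carrier → Prop) :
    (Set.univ : Set M).Definable L {v : Fin n ⊕ Fin n → M |
      ∃ a b, P a b ∧ a.1 = v ∘ Sum.inl ∧ b.1 = v ∘ Sum.inr} ↔
    G.DefRel {g : Bool → G.Carrier | P (g false) (g true)} := by
  constructor
  · intro h
    have h' := h.preimage_comp (Sum.elim (fun j => (false, j)) fun j => (true, j))
    rw [DefRel]
    convert h' using 1
    ext v
    constructor
    · rintro ⟨g, hg, rfl⟩
      exact ⟨_, _, hg, rfl, rfl⟩
    · rintro ⟨a, b, hab, ha, hb⟩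
      refine ⟨fun i => cond i b a, hab, ?_⟩
      ext ⟨i, j⟩
      cases i
      · exact congrFun ha j
      · exact congrFun hb j
  · intro h
    have h' := Set.Definable.preimage_comp
      (fun p : Bool × Fin n => p.1.rec (Sum.inl p.2) (Sum.inr p.2) : _ → Fin n ⊕ Fin n) h
    convert h' using 1
    ext v
    constructor
    · rintro ⟨a, b, hab, ha, hb⟩
      refine ⟨fun i => cond i b a, hab, ?_⟩
      ext ⟨i, j⟩
      cases i
      · exact congrFun ha j
      · exact congrFun hb j
    · rintro ⟨g, hg, h⟩
      exact ⟨_, _, hg, funext fun j => congrFun h (false, j), funext fun j => congrFun h (true, j)⟩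

theorem definable_set {P : G.Carrier → Prop} :
    (Set.univ : Set M).Definable L {x : Fin n → M | ∃ a, P a ∧ a.1 = x} ↔
    G.DefRel {g : Unit → G.Carrier | P (g ())} := by
  constructor
  · intro h
    have h' := h.preimage_comp fun j => ((), j)
    rw [DefRel]
    convert h' using 1
    ext v
    constructor
    · rintro ⟨g, hg, rfl⟩
      exact ⟨_, hg, rfl⟩
    · rintro ⟨a, ha, h⟩
      exact ⟨fun _ => a, ha, funext fun p => congrFun h p.2⟩
  · intro h
    have h' := Set.Definable.preimage_comp (fun p : Unit × Fin n => p.2) h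
    convert h' using 1
    ext v
    constructor
    · rintro ⟨a, ha, h⟩
      exact ⟨fun _ => a, ha, funext fun p => congrFun h p.2⟩
    · rintro ⟨g, hg, h⟩
      exact ⟨_, hg, funext fun j => congrFun h ((), j)⟩

end DefRel

variable {B B' : AddSubgroup G.Carrier} {φ ψ : AddSubgroup (G.Carrier × G.Carrier)}

theorem isDefinableSubgroup_iff :
    G.IsDefinableSubgroup B ↔ G.DefRel {g : Unit → G.Carrier | g () ∈ B} :=
  DefRel.definable_set

/-- An additive relation on the group is definable with parameters. -/
def IsDefinableRelation (G : DefAbGroup L C n) (φ : AddSubgroup (G.Carrier × G.Carrier)) : Prop :=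
  G.DefRel {g : Bool → G.Carrier | (g false, g true) ∈ φ}

theorem mem_defEndog_iff : φ ∈ G.defEndog ↔ IsEndogeny φ ∧ G.IsDefinableRelation φ := by
  refine and_congr_right fun _ => ?_
  rw [IsDefinableRelation, ← DefRel.definable_pairs fun a b => (a, b) ∈ φ]
  apply iff_of_eq
  congr 1
  ext v
  constructor
  · rintro ⟨⟨a, b⟩, h, ha, hb⟩
    exact ⟨a, b, h, ha, hb⟩
  · rintro ⟨a, b, h, ha, hb⟩
    exact ⟨(a, b), h, ha, hb⟩

theorem IsDefinableSubgroup.mem [Finite ι] (hB : G.IsDefinableSubgroup B) (i : ι) :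
    G.DefRel {g : ι → G.Carrier | g i ∈ B} :=
  DefRel.reindex (P := fun g : Unit → G.Carrier => g () ∈ B) (isDefinableSubgroup_iff.1 hB)
    fun _ => i

theorem IsDefinableRelation.mem [Finite ι] (hφ : G.IsDefinableRelation φ) (i j : ι) :
    G.DefRel {g : ι → G.Carrier | (g i, g j) ∈ φ} :=
  DefRel.reindex (P := fun g : Bool → G.Carrier => (g false, g true) ∈ φ) hφ fun b => cond b j i

namespace IsDefinableSubgroup

theorem top : G.IsDefinableSubgroup ⊤ :=
  isDefinableSubgroup_iff.2 (by simpa using! DefRel.univ (G := G) (ι := Unit))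

theorem bot : G.IsDefinableSubgroup ⊥ :=
  isDefinableSubgroup_iff.2 (by simpa using! DefRel.eq_const (G := G) () 0)

theorem inf (hB : G.IsDefinableSubgroup B) (hB' : G.IsDefinableSubgroup B') :
    G.IsDefinableSubgroup (B ⊓ B') :=
  isDefinableSubgroup_iff.2 (.and (hB.mem ()) (hB'.mem ()))

theorem sup (hB : G.IsDefinableSubgroup B) (hB' : G.IsDefinableSubgroup B') :
    G.IsDefinableSubgroup (B ⊔ B') := by
  have : G.DefRel {g : Unit → G.Carrier | ∃ b, b ∈ B ∧ ∃ c, c ∈ B' ∧ b + c = g ()} :=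
    .ex (.and (hB.mem none) (.ex (.and (hB'.mem none)
      (.add (some none) none (some (some ()))))))
  rw [isDefinableSubgroup_iff]
  simpa only [AddSubgroup.mem_sup] using this

theorem image (hφ : G.IsDefinableRelation φ) (hB : G.IsDefinableSubgroup B) :
    G.IsDefinableSubgroup (image φ B) :=
  isDefinableSubgroup_iff.2 (.ex (.and (hB.mem none) (hφ.mem none (some ()))))

theorem ker (hφ : G.IsDefinableRelation φ) : G.IsDefinableSubgroup (ker φ) := by
  have : G.DefRel {g : Unit → G.Carrier | ∃ z, z = 0 ∧ (g (), z) ∈ φ} :=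
    .ex (.and (.eq_const none 0) (hφ.mem (some ()) none))
  simp only [exists_eq_left] at this
  exact isDefinableSubgroup_iff.2 this

end IsDefinableSubgroup

namespace IsDefinableRelation

theorem addE (hφ : G.IsDefinableRelation φ) (hψ : G.IsDefinableRelation ψ) :
    G.IsDefinableRelation (addE φ ψ) :=
  .ex (.ex (.and (hφ.mem (some (some false)) (some none))
    (.and (hψ.mem (some (some false)) none) (.add (some none) none (some (some true))))))

theorem negE (hφ : G.IsDefinableRelation φ) : G.IsDefinableRelation (negE φ) := by
  have : G.DefRel {g : Bool → G.Carrier | ∃ z, z = 0 ∧ ∃ y, g true + y = z ∧ (g false, y) ∈ φ} :=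
    .ex (.and (.eq_const none 0) (.ex (.and (.add (some (some true)) none (some none))
      (hφ.mem (some (some false)) none))))
  simp only [exists_eq_left, add_eq_zero_iff_neg_eq, exists_eq_left'] at this
  exact this

theorem compE (hφ : G.IsDefinableRelation φ) (hψ : G.IsDefinableRelation ψ) :
    G.IsDefinableRelation (compE φ ψ) :=
  .ex (.and (hψ.mem (some false) none) (hφ.mem none (some true)))

theorem zeroE : G.IsDefinableRelation zeroE := by
  simpa only [IsDefinableRelation, mem_zeroE] using DefRel.eq_const (G := G) true 0

theorem oneE : G.IsDefinableRelation oneE := by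
  simpa only [IsDefinableRelation, mem_oneE] using DefRel.eq (G := G) false true

theorem top_prod (hB : G.IsDefinableSubgroup B) :
    G.IsDefinableRelation ((⊤ : AddSubgroup G.Carrier).prod B) := by
  simpa [IsDefinableRelation, AddSubgroup.mem_prod] using hB.mem true

end IsDefinableRelation

/-! ### The dimension of definable subgroups -/

section Dimension

open scoped Classical in
/-- The class of a tuple modulo a subgroup `B`; all the tuples outside the group form one class. -/
noncomputable def cosetOf (G : DefAbGroup L C n) (B : AddSubgroup G.Carrier) (x : Fin n → M) :
    Option (G.Carrier ⧸ B) :=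
  if h : G.dom.Realize (Sum.elim Subtype.val x) then some (QuotientAddGroup.mk ⟨x, h⟩) else none

/-- The definable equivalence relation on tuples whose classes are the cosets of `B` (and the
complement of the group). -/
noncomputable def cosetSetoid (G : DefAbGroup L C n) (B : AddSubgroup G.Carrier) :
    Setoid (Fin n → M) :=
  Setoid.ker (G.cosetOf B)

/-- The interpretable set of the cosets of `B` that meet `S`. -/
def cosets (G : DefAbGroup L C n) (B : AddSubgroup G.Carrier) (S : Set G.Carrier) :
    Set (Quotient (G.cosetSetoid B)) :=
  (fun a : G.Carrier => Quotient.mk (G.cosetSetoid B) a.1) '' S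

theorem cosetOf_coe (a : G.Carrier) : G.cosetOf B a.1 = some (a : G.Carrier ⧸ B) := by
  rw [cosetOf, dif_pos a.2]

theorem mk_eq_iff {x y : Fin n → M} : Quotient.mk (G.cosetSetoid B) x =
    Quotient.mk (G.cosetSetoid B) y ↔ G.cosetOf B x = G.cosetOf B y :=
  Quotient.eq

theorem mk_coe_eq_iff {a b : G.Carrier} : Quotient.mk (G.cosetSetoid B) a.1 =
    Quotient.mk (G.cosetSetoid B) b.1 ↔ a - b ∈ B := by
  rw [mk_eq_iff, cosetOf_coe, cosetOf_coe, Option.some_inj, QuotientAddGroup.eq_iff_sub_mem]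

theorem exists_of_mk_coe_eq {a : G.Carrier} {y : Fin n → M} (h : Quotient.mk (G.cosetSetoid B) a.1 =
    Quotient.mk (G.cosetSetoid B) y) : ∃ b : G.Carrier, b.1 = y := by
  rw [mk_eq_iff, cosetOf_coe] at h
  by_contra hno
  rw [cosetOf, dif_neg fun hy => hno ⟨⟨y, hy⟩, rfl⟩] at h
  cases h

theorem mk_mem_cosets {x : Fin n → M} {S : Set G.Carrier} :
    Quotient.mk (G.cosetSetoid B) x ∈ G.cosets B S ↔
      ∃ a : G.Carrier, (∃ s ∈ S, s - a ∈ B) ∧ a.1 = x := by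
  constructor
  · rintro ⟨s, hs, h⟩
    obtain ⟨a, rfl⟩ := exists_of_mk_coe_eq h
    exact ⟨a, ⟨s, hs, mk_coe_eq_iff.1 h⟩, rfl⟩
  · rintro ⟨a, ⟨s, hs, h⟩, rfl⟩
    exact ⟨s, hs, mk_coe_eq_iff.2 h⟩

theorem definable_sub_mem [Finite ι] (hB : G.IsDefinableSubgroup B) (i j : ι) :
    G.DefRel {g : ι → G.Carrier | g i - g j ∈ B} := by
  have : G.DefRel {g : ι → G.Carrier | ∃ b, b ∈ B ∧ b + g j = g i} :=
    .ex (.and (hB.mem none) (.add none (some j) (some i)))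
  convert this using 3 with g
  constructor
  · exact fun h => ⟨_, h, by simp⟩
  · rintro ⟨b, hb, h⟩
    rwa [← h, add_sub_cancel_right]

theorem isInterpretable_cosets (hB : G.IsDefinableSubgroup B) {S : Set G.Carrier}
    (hS : G.DefRel {g : Unit → G.Carrier | g () ∈ S}) :
    IsInterpretable L (G.cosetSetoid B) (G.cosets B S) := by
  have hdom := definable_setOf_realize G.dom (Subtype.val : C → M)
  constructor
  · have h1 := (DefRel.definable_pairs fun a b => a - b ∈ B).2 (definable_sub_mem hB false true)
    have h2 := (hdom.preimage_comp (Sum.inl : Fin n → Fin n ⊕ Fin n)).compl.inter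
      (hdom.preimage_comp (Sum.inr : Fin n → Fin n ⊕ Fin n)).compl
    convert h1.union h2 using 1
    ext v
    constructor
    · intro h
      change G.cosetOf B _ = G.cosetOf B _ at h
      by_cases hv : G.dom.Realize (Sum.elim Subtype.val (v ∘ Sum.inl))
      · left
        have h' : Quotient.mk (G.cosetSetoid B) (⟨_, hv⟩ : G.Carrier).1 =
          Quotient.mk (G.cosetSetoid B) (v ∘ Sum.inr) := mk_eq_iff.2 h
        obtain ⟨b, hb⟩ := exists_of_mk_coe_eq h'
        rw [← hb, mk_coe_eq_iff] at h'
        exact ⟨_, b, h', rfl, hb⟩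
      · right
        refine ⟨hv, fun hv' => ?_⟩
        have h' : Quotient.mk (G.cosetSetoid B) (⟨_, hv'⟩ : G.Carrier).1 =
          Quotient.mk (G.cosetSetoid B) (v ∘ Sum.inl) := mk_eq_iff.2 h.symm
        obtain ⟨b, hb⟩ := exists_of_mk_coe_eq h'
        exact hv (hb ▸ b.2)
    · rintro (⟨a, b, h, ha, hb⟩ | ⟨h, h'⟩)
      · change G.cosetOf B _ = G.cosetOf B _
        rw [← ha, ← hb]
        exact mk_eq_iff.1 (mk_coe_eq_iff.2 h)
      · change G.cosetOf B _ = G.cosetOf B _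
        have e : ∀ x : Fin n → M, ¬ G.dom.Realize (Sum.elim Subtype.val x) →
            G.cosetOf B x = none := fun x hx => dif_neg hx
        rw [e _ h, e _ h']
  · simp only [mk_mem_cosets]
    refine DefRel.definable_set.2 (.ex (.and ?_ (definable_sub_mem hB none (some ()))))
    exact DefRel.reindex (P := fun g : Unit → G.Carrier => g () ∈ S) hS fun _ => none

open scoped Classical in
/-- The map from the cosets of the trivial subgroup to the cosets of `B` induced by a map `t` on the
group. Its values at the class of the tuples outside the group are irrelevant. -/
noncomputable def cosetMap (G : DefAbGroup L C n) (B : AddSubgroup G.Carrier)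
    (t : G.Carrier → G.Carrier) (c : Quotient (G.cosetSetoid ⊥)) : Quotient (G.cosetSetoid B) :=
  if h : ∃ a : G.Carrier, Quotient.mk (G.cosetSetoid ⊥) a.1 = c then
    Quotient.mk _ (t h.choose).1
  else Quotient.mk _ c.out

theorem cosetMap_mk {t : G.Carrier → G.Carrier} (a : G.Carrier) :
    G.cosetMap B t (Quotient.mk _ a.1) = Quotient.mk _ (t a).1 := by
  have h : ∃ b : G.Carrier, Quotient.mk (G.cosetSetoid ⊥) b.1 = Quotient.mk _ a.1 := ⟨a, rfl⟩
  rw [cosetMap, dif_pos h, sub_eq_zero.1 (AddSubgroup.mem_bot.1 (mk_coe_eq_iff.1 h.choose_spec))]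

variable {T : L.Theory} (D : DimensionFunction T)

/-- The dimension of the set of cosets of `B` that meet `S`. -/
noncomputable def dimCosets (D : DimensionFunction T) (B : AddSubgroup G.Carrier)
    (S : Set G.Carrier) : WithBot ℕ :=
  D.dim M (G.cosetSetoid B) (G.cosets B S)

section

variable [Nonempty M] (hMT : M ⊨ T) (hM : IsSaturated L ℵ₀ M)
include hMT hM

theorem dimCosets_nonneg (hB : G.IsDefinableSubgroup B) {S : Set G.Carrier}
    (hS : G.DefRel {g : Unit → G.Carrier | g () ∈ S}) {a : G.Carrier} (ha : a ∈ S) :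
    0 ≤ dimCosets D B S := by
  have h1 := isInterpretable_cosets hB hS
  have h2 : IsInterpretable L (G.cosetSetoid B) (G.cosets B {a}) :=
    isInterpretable_cosets hB (DefRel.eq_const () a)
  have h3 := D.dim_union M hMT hM _ _ _ h1 h2
  have h4 : G.cosets B S ∪ G.cosets B {a} = G.cosets B S := by
    rw [cosets, cosets, ← Set.image_union, Set.union_eq_left.2 (by simpa using ha)]
  have h5 : D.dim M _ (G.cosets B {a}) = 0 :=
    (D.dim_eq_zero_iff M hMT hM _ _ h2 (by simp [cosets])).2 (by simp [cosets])
  rw [h4, h5] at h3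
  rw [dimCosets, h3]
  exact le_max_right _ _

theorem dimCosets_mono (hB : G.IsDefinableSubgroup B) {S S' : Set G.Carrier}
    (hS : G.DefRel {g : Unit → G.Carrier | g () ∈ S})
    (hS' : G.DefRel {g : Unit → G.Carrier | g () ∈ S'}) (h : S ⊆ S') :
    dimCosets D B S ≤ dimCosets D B S' := by
  have h3 := D.dim_union M hMT hM _ _ _ (isInterpretable_cosets hB hS)
    (isInterpretable_cosets hB hS')
  have h4 : G.cosets B S ∪ G.cosets B S' = G.cosets B S' := by
    rw [cosets, cosets, ← Set.image_union, Set.union_eq_right.2 h]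
  rw [h4] at h3
  rw [dimCosets, dimCosets, h3]
  exact le_max_left _ _

theorem dimCosets_add_le (hB : G.IsDefinableSubgroup B) {S S' : Set G.Carrier}
    (hS : G.DefRel {g : Unit → G.Carrier | g () ∈ S})
    (hS' : G.DefRel {g : Unit → G.Carrier | g () ∈ S'}) {t : G.Carrier → G.Carrier}
    (ht : Set.MapsTo t S S')
    (htd : G.DefRel {g : Bool → G.Carrier | g false ∈ S ∧ t (g false) - g true ∈ B}) {k : ℕ}
    (hk : ∀ y ∈ S', (k : WithBot ℕ) ≤ dimCosets D ⊥ {a ∈ S | t a - y ∈ B}) :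
    dimCosets D B S' + k ≤ dimCosets D ⊥ S := by
  refine D.le_dim M hMT hM _ _ _ _ (G.cosetMap B t)
    (isInterpretable_cosets .bot hS) (isInterpretable_cosets hB hS') ⟨?_, ?_⟩ k ?_
  · rintro _ ⟨a, ha, rfl⟩
    exact ⟨t a, ht ha, (cosetMap_mk a).symm⟩
  · convert (DefRel.definable_pairs fun a b => a ∈ S ∧ t a - b ∈ B).2 htd using 1
    ext v
    constructor
    · rintro ⟨h1, h2⟩
      obtain ⟨a, ha, h3⟩ := h1
      obtain ⟨a', h4⟩ := exists_of_mk_coe_eq h3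
      rw [← h4, mk_coe_eq_iff, AddSubgroup.mem_bot, sub_eq_zero] at h3
      subst h3
      rw [← h4, cosetMap_mk] at h2
      obtain ⟨b, h5⟩ := exists_of_mk_coe_eq h2
      rw [← h5, mk_coe_eq_iff] at h2
      exact ⟨a, b, ⟨ha, h2⟩, h4, h5⟩
    · rintro ⟨a, b, ⟨ha, h⟩, h1, h2⟩
      rw [Set.mem_ofPred_eq, ← h1, ← h2, cosetMap_mk, mk_coe_eq_iff]
      exact ⟨⟨a, ha, rfl⟩, h⟩
  · rintro _ ⟨y, hy, rfl⟩
    refine (hk y hy).trans (le_of_eq ?_)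
    rw [dimCosets]
    congr 1
    ext c
    constructor
    · rintro ⟨a, ⟨ha, h⟩, rfl⟩
      exact ⟨⟨a, ha, rfl⟩, (cosetMap_mk a).trans (mk_coe_eq_iff.2 h)⟩
    · rintro ⟨⟨a, ha, rfl⟩, h⟩
      exact ⟨a, ⟨ha, mk_coe_eq_iff.1 ((cosetMap_mk a).symm.trans h)⟩, rfl⟩

/-- Translates of a definable subgroup have at least its dimension (translation is a definable
injection). -/
theorem dimCosets_le_translate (hB : G.IsDefinableSubgroup B) (c : G.Carrier) :
    dimCosets D ⊥ (B : Set G.Carrier) ≤ dimCosets D ⊥ {a | a - c ∈ B} := by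
  have hS : G.DefRel {g : Unit → G.Carrier | g () - c ∈ B} := by
    have : G.DefRel {g : Unit → G.Carrier | ∃ z, z = c ∧ g () - z ∈ B} :=
      .ex (.and (.eq_const none c) (definable_sub_mem hB (some ()) none))
    simpa using this
  have key := dimCosets_add_le D hMT hM (B := ⊥) .bot (S := {a | a - c ∈ B}) (S' := (B : Set _))
    hS (isDefinableSubgroup_iff.1 hB) (t := fun a => a - c) (fun a ha => ha) ?_ (k := 0) ?_
  · simpa using key
  · have : G.DefRel {g : Bool → G.Carrier | g false - c ∈ B ∧
        ∃ z, z = c ∧ g true + z = g false} := by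
      refine .and ?_ (.ex (.and (.eq_const none c) (.add (some true) none (some false))))
      exact DefRel.reindex (P := fun g : Unit → G.Carrier => g () - c ∈ B) hS fun _ => false
    convert this using 3 with g
    simp only [Set.mem_ofPred_eq, AddSubgroup.mem_bot, exists_eq_left]
    refine and_congr_right fun _ => ?_
    rw [sub_eq_zero, sub_eq_iff_eq_add, eq_comm]
  · intro y hy
    refine dimCosets_nonneg D hMT hM .bot ?_ (a := y + c) ⟨by simpa using hy, by simp⟩
    have : G.DefRel {g : Unit → G.Carrier | g () - c ∈ B ∧ g () = y + c} :=
      .and hS (.eq_const () _)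
    convert this using 3 with g
    simp only [Set.mem_ofPred_eq, AddSubgroup.mem_bot, sub_eq_iff_eq_add, zero_add]

theorem dimCosets_add_le_of_le (hB : G.IsDefinableSubgroup B) (hB' : G.IsDefinableSubgroup B')
    (hle : B ≤ B') {k : ℕ} (hk : (k : WithBot ℕ) ≤ dimCosets D ⊥ (B : Set G.Carrier)) :
    dimCosets D B (B' : Set G.Carrier) + k ≤ dimCosets D ⊥ (B' : Set G.Carrier) := by
  refine dimCosets_add_le D hMT hM hB (isDefinableSubgroup_iff.1 hB')
    (isDefinableSubgroup_iff.1 hB') (t := id) (fun _ h => h)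
    (.and (hB'.mem false) (definable_sub_mem hB false true)) fun y hy => ?_
  refine (hk.trans (dimCosets_le_translate D hMT hM hB y)).trans (le_of_eq ?_)
  congr 1
  ext a
  refine ⟨fun h => ⟨?_, h⟩, fun h => h.2⟩
  rw [← sub_add_cancel a y]
  exact B'.add_mem (hle h) hy

/-- The dimension of a finite-dimensional theory, restricted to the definable subgroups of a
definable group. Strict monotonicity holds because the set of cosets `B'/B` is interpretable, and of
positive dimension if it is infinite. -/
noncomputable def dimensionLattice (G : DefAbGroup L C n) : DimensionLattice G.Carrier where
  carrier := {B | G.IsDefinableSubgroup B}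
  dim B := (dimCosets D ⊥ (B : Set G.Carrier)).unbotD 0
  top_mem := .top
  inf_mem := .inf
  sup_mem := .sup
  dim_mono {B B'} hB hB' h :=
    WithBot.unbotD_mono
      (ne_bot_of_le_ne_bot WithBot.zero_ne_bot
        (dimCosets_nonneg D hMT hM .bot (isDefinableSubgroup_iff.1 hB) B.zero_mem))
      (dimCosets_mono D hMT hM .bot (isDefinableSubgroup_iff.1 hB)
        (isDefinableSubgroup_iff.1 hB') h)
  dim_lt {B B'} hB hB' h hno := by
    have h0 := dimCosets_nonneg D hMT hM .bot (isDefinableSubgroup_iff.1 hB) B.zero_mem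
    have h1 := dimCosets_nonneg D hMT hM hB (isDefinableSubgroup_iff.1 hB') B'.zero_mem
    obtain ⟨k, hk⟩ := WithBot.ne_bot_iff_exists.1 (ne_bot_of_le_ne_bot WithBot.zero_ne_bot h0)
    have h2 := dimCosets_add_le_of_le D hMT hM hB hB' h (k := k) hk.le
    have h3 : dimCosets D B (B' : Set G.Carrier) ≠ 0 := by
      intro h3
      have hfin := (D.dim_eq_zero_iff M hMT hM _ _
        (isInterpretable_cosets hB (isDefinableSubgroup_iff.1 hB'))
        ⟨_, Set.mem_image_of_mem _ B'.zero_mem⟩).1 h3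
      refine hno ⟨_, hfin.image (Function.invFunOn (fun a : G.Carrier =>
        Quotient.mk (G.cosetSetoid B) a.1) (B' : Set G.Carrier)), fun b hb => ?_⟩
      have hb' := Set.mem_image_of_mem (fun a : G.Carrier =>
        Quotient.mk (G.cosetSetoid B) a.1) hb
      exact ⟨_, Set.mem_image_of_mem _ hb', mk_coe_eq_iff.1 (Function.invFunOn_eq hb').symm⟩
    obtain ⟨j, hj⟩ := WithBot.ne_bot_iff_exists.1 (ne_bot_of_le_ne_bot WithBot.zero_ne_bot h1)
    rw [← hj] at h2 h3
    have hlt : ((k + 1 : ℕ) : WithBot ℕ) ≤ dimCosets D ⊥ (B' : Set G.Carrier) := by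
      refine le_trans ?_ h2
      have : j ≠ 0 := fun h => h3 (by rw [h]; rfl)
      exact WithBot.coe_le_coe.2 (show k + 1 ≤ j + k by omega)
    rw [← hk, WithBot.unbotD_coe]
    exact WithBot.le_unbotD hlt

end

end Dimension

end DefAbGroup

/-! ### Saturation -/

section Saturation

variable {L : FirstOrder.Language.{u, u}} {M : Type u} [L.Structure M] {κ : Cardinal.{u}}

theorem IsSaturated.mono {κ' : Cardinal.{u}} (h : κ' ≤ κ) (hM : IsSaturated L κ M) :
    IsSaturated L κ' M := fun B hB => hM B (hB.trans_le h)

/-- Saturation for families of formulas, with the parameters given by a map `w` and with an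
arbitrary finite set of variables. -/
theorem IsSaturated.exists_realize (hM : IsSaturated L κ M) {β : Type u} (hβ : #β < κ) (w : β → M)
    {ξ I : Type*} [Finite ξ] (F : I → L.Formula (β ⊕ ξ))
    (h : ∀ s : Finset I, ∃ x : ξ → M, ∀ i ∈ s, (F i).Realize (Sum.elim w x)) :
    ∃ x : ξ → M, ∀ i, (F i).Realize (Sum.elim w x) := by
  classical
  obtain ⟨m, ⟨e⟩⟩ := Finite.exists_equiv_fin ξ
  let r : β ⊕ ξ → Set.range w ⊕ Fin m := Sum.map (Set.rangeFactorization w) e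
  have hr : ∀ (ψ : L.Formula (β ⊕ ξ)) (x : Fin m → M),
      (ψ.relabel r).Realize (Sum.elim Subtype.val x) ↔ ψ.Realize (Sum.elim w (x ∘ e)) := by
    intro ψ x
    rw [Formula.realize_relabel]
    have : Sum.elim (fun b : Set.range w => b.1) x ∘ r = Sum.elim w (x ∘ e) := by
      ext y
      cases y <;> rfl
    rw [← this]
  obtain ⟨x, hx⟩ := hM (Set.range w) (mk_range_le.trans_lt hβ) m
    (Set.range fun i => (F i).relabel r) fun q hq hqf => by
      obtain ⟨s, hs⟩ : ∃ s : Finset I, ∀ ψ ∈ q, ∃ i ∈ s, (F i).relabel r = ψ := by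
        choose g hg using fun ψ : q => hq ψ.2
        have := hqf.fintype
        exact ⟨Finset.univ.image g, fun ψ hψ => ⟨g ⟨ψ, hψ⟩,
          Finset.mem_image_of_mem _ (Finset.mem_univ _), hg ⟨ψ, hψ⟩⟩⟩
      obtain ⟨x, hx⟩ := h s
      refine ⟨x ∘ e.symm, fun ψ hψ => ?_⟩
      obtain ⟨i, hi, rfl⟩ := hs ψ hψ
      rw [hr]
      convert hx i hi using 2
      ext y
      simp
  exact ⟨x ∘ e, fun i => (hr _ _).1 (hx _ ⟨i, rfl⟩)⟩

/-- A small type over `M` that is realized in an elementary extension is realized in `M`. -/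
theorem IsSaturated.exists_realize_of_extension (hM : IsSaturated L κ M) {β : Type u} (hβ : #β < κ)
    (w : β → M) {N : Type u} [L.Structure N] (f : M ↪ₑ[L] N) {ξ I : Type*} [Finite ξ]
    (F : I → L.Formula (β ⊕ ξ)) {x : ξ → N}
    (h : ∀ i, (F i).Realize (Sum.elim (f ∘ w) x)) :
    ∃ x : ξ → M, ∀ i, (F i).Realize (Sum.elim w x) := by
  refine hM.exists_realize hβ w F fun s => ?_
  have h1 : (Formula.iExs ξ (Formula.iInf fun i : s => F i.1)).Realize (f ∘ w) := by
    rw [Formula.realize_iExs]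
    exact ⟨x, Formula.realize_iInf.2 fun i => h i⟩
  rw [ElementaryEmbedding.map_formula, Formula.realize_iExs] at h1
  obtain ⟨x, hx⟩ := h1
  exact ⟨x, fun i hi => Formula.realize_iInf.1 hx ⟨i, hi⟩⟩

/-- "At least `k` tuples satisfy `χ`" is expressed by a formula. -/
theorem exists_formula_injective {α : Type*} {n : ℕ} (χ : L.Formula (α ⊕ Fin n)) (k : ℕ) :
    ∃ θ : L.Formula α, ∀ (N : Type u) [L.Structure N] (v : α → N), θ.Realize v ↔
      ∃ f : Fin k → Fin n → N, f.Injective ∧ ∀ i, χ.Realize (Sum.elim v (f i)) := by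
  let eqn : Fin k × Fin k → L.Formula (α ⊕ (Fin k × Fin n)) := fun p =>
    Formula.iInf fun j : Fin n =>
      Term.equal (Term.var (Sum.inr (p.1, j))) (Term.var (Sum.inr (p.2, j)))
  let all : L.Formula (α ⊕ (Fin k × Fin n)) :=
    (Formula.iInf fun p : {p : Fin k × Fin k // p.1 ≠ p.2} => (eqn p.1).not) ⊓
      Formula.iInf fun i : Fin k => χ.relabel (Sum.map id fun j => (i, j))
  have hall : ∀ (N : Type u) [L.Structure N] (v : α → N) (f : Fin k → Fin n → N),
      all.Realize (Sum.elim v fun p => f p.1 p.2) ↔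
        f.Injective ∧ ∀ i, χ.Realize (Sum.elim v (f i)) := by
    intro N _ v f
    have h1 : ∀ i, Sum.elim v (fun p : Fin k × Fin n => f p.1 p.2) ∘
        Sum.map id (fun j => (i, j)) = Sum.elim v (f i) := by
      intro i
      ext y
      cases y <;> rfl
    simp only [all, eqn, Formula.realize_inf, Formula.realize_iInf, Formula.realize_relabel, h1,
      Formula.realize_not, Formula.realize_equal, Term.realize_var, Sum.elim_inr]
    refine and_congr_left fun _ => ?_
    simp only [← funext_iff, Subtype.forall, Prod.forall]
    exact ⟨fun h i j hij => by_contra fun hne => h i j hne hij, fun h i j hne hij => hne (h hij)⟩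
  refine ⟨Formula.iExs _ all, fun N _ v => ?_⟩
  rw [Formula.realize_iExs]
  constructor
  · rintro ⟨x, hx⟩
    exact ⟨fun i j => x (i, j), (hall N v _).1 hx⟩
  · rintro ⟨f, hf⟩
    exact ⟨_, (hall N v f).2 hf⟩

theorem infinite_iff_forall_injective {α : Type*} (S : Set α) :
    ¬ S.Finite ↔ ∀ k : ℕ, ∃ f : Fin k → α, f.Injective ∧ ∀ i, f i ∈ S := by
  constructor
  · intro h k
    exact ⟨fun i => (Set.Infinite.natEmbedding S h i).1, fun i j hij => Fin.ext
      ((Set.Infinite.natEmbedding S h).injective (Subtype.ext hij)), fun i => Subtype.prop _⟩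
  · intro h hS
    obtain ⟨f, hf, hfS⟩ := h (S.ncard + 1)
    have := hS.to_subtype
    have := Nat.card_le_card_of_injective (fun i => (⟨f i, hfS i⟩ : S))
      fun i j hij => hf (congrArg Subtype.val hij)
    rw [Nat.card_fin, Nat.card_coe_set_eq] at this
    omega

end Saturation

/-! ### Essentially unbounded families -/

/-- The member of the `i`-th part of an invariant family given by the parameter tuple `b`. -/
def InvariantFamily.member {L : FirstOrder.Language.{u, u}} {M : Type u} {C : Set M} {n : ℕ}
    (Γ : InvariantFamily L C n) (i : Γ.ι) {N : Type u} [L.Structure N]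
    (c : C → N) (b : Fin (Γ.arity i) → N) : Set ((Fin n → N) × (Fin n → N)) :=
  {xy | (Γ.formula i).Realize (Sum.elim c (Sum.elim b (Sum.elim xy.1 xy.2)))}

namespace DefAbGroup

variable {L : FirstOrder.Language.{u, u}} {M : Type u} [L.Structure M] {C : Set M} {n : ℕ}
  {G : DefAbGroup L C n} {Γ : InvariantFamily L C n}

/-- "The set `(φ_b - φ_b')[A]` has at least `k` elements" is expressed by a formula. -/
theorem exists_formula_differenceImage (G : DefAbGroup L C n) (Γ : InvariantFamily L C n)
    (i : Γ.ι) (k : ℕ) :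
    ∃ θ : L.Formula (C ⊕ (Fin (Γ.arity i) ⊕ Fin (Γ.arity i))), ∀ (N : Type u) [L.Structure N]
      (c : C → N) (b b' : Fin (Γ.arity i) → N), θ.Realize (Sum.elim c (Sum.elim b b')) ↔
        ∃ f : Fin k → Fin n → N, f.Injective ∧
          ∀ j, f j ∈ G.differenceImage c (Γ.member i c b) (Γ.member i c b') := by
  let V := (C ⊕ (Fin (Γ.arity i) ⊕ Fin (Γ.arity i))) ⊕ Fin n
  -- the variables `x`, `y`, `y'`
  let χ : L.Formula (V ⊕ (Fin n ⊕ (Fin n ⊕ Fin n))) :=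
    ((Γ.formula i).relabel (Sum.elim (fun c => .inl (.inl (.inl c)))
      (Sum.elim (fun t => .inl (.inl (.inr (.inl t))))
        (Sum.elim (fun t => .inr (.inl t)) fun t => .inr (.inr (.inl t)))))) ⊓
    (((Γ.formula i).relabel (Sum.elim (fun c => .inl (.inl (.inl c)))
      (Sum.elim (fun t => .inl (.inl (.inr (.inr t))))
        (Sum.elim (fun t => .inr (.inl t)) fun t => .inr (.inr (.inr t)))))) ⊓
    (G.add.relabel (Sum.elim (fun c => .inl (.inl (.inl c)))
      (Sum.elim (fun t => .inl (.inr t))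
        (Sum.elim (fun t => .inr (.inr (.inr t))) fun t => .inr (.inr (.inl t)))))))
  let χ' : L.Formula V := (G.dom.relabel (Sum.elim (fun c => .inl (.inl c)) fun t => .inr t)) ⊓
    Formula.iExs _ χ
  obtain ⟨θ, hθ⟩ := exists_formula_injective χ' k
  refine ⟨θ, fun N _ c b b' => ?_⟩
  rw [hθ]
  refine exists_congr fun f => and_congr_right fun _ => forall_congr' fun j => ?_
  simp only [χ', χ, Formula.realize_inf, Formula.realize_iExs, Formula.realize_relabel,
    differenceImage, InvariantFamily.member]
  have key : ∀ {α : Type u} {φ : L.Formula α} {v v' : α → N}, φ.Realize v → v = v' →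
      φ.Realize v' := fun h e => e ▸ h
  refine and_congr (iff_of_eq ?_) ?_
  · congr 1
    ext y
    cases y <;> rfl
  constructor
  · rintro ⟨x, h1, h2, h3⟩
    refine ⟨fun t => x (.inl t), fun t => x (.inr (.inl t)), fun t => x (.inr (.inr t)), ?_, ?_, ?_⟩
    · exact key h1 (by ext y; rcases y with y | y | y | y <;> rfl)
    · exact key h2 (by ext y; rcases y with y | y | y | y <;> rfl)
    · exact key h3 (by ext y; rcases y with y | y | y | y <;> rfl)
  · rintro ⟨x, y, y', h1, h2, h3⟩
    refine ⟨Sum.elim x (Sum.elim y y'), ?_, ?_, ?_⟩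
    · exact key h1 (by ext y; rcases y with y | y | y | y <;> rfl)
    · exact key h2 (by ext y; rcases y with y | y | y | y <;> rfl)
    · exact key h3 (by ext y; rcases y with y | y | y | y <;> rfl)

/-- The `i`-th part of the family `Γ` has arbitrarily many pairwise inequivalent members in `N`. -/
def HasManyMembers (G : DefAbGroup L C n) (Γ : InvariantFamily L C n) (i : Γ.ι) {N : Type u}
    [L.Structure N] (c : C → N) : Prop :=
  ∀ m : ℕ, ∃ b : Fin m → Fin (Γ.arity i) → N,
    (∀ j, ∀ ψ ∈ Γ.type i, ψ.Realize (Sum.elim c (b j))) ∧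
    ∀ j k, j ≠ k → ¬ (G.differenceImage c (Γ.member i c (b j)) (Γ.member i c (b k))).Finite

/-- If all the parts of a family had only boundedly many inequivalent members, then the whole family
would be small; so an essentially unbounded family has a part with many inequivalent members. -/
theorem EssentiallyUnbounded.exists_hasManyMembers (h : G.EssentiallyUnbounded Γ) :
    ∃ (i : Γ.ι) (N : Type u) (_ : L.Structure N) (f : M ↪ₑ[L] N),
      G.HasManyMembers Γ i (fun c : C => f c) := by
  obtain ⟨N, _, f, hN⟩ := h (#Γ.ι * ℵ₀)
  let c : C → N := fun c => f c
  by_contra! hno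
  let part : Γ.ι → Set (Set ((Fin n → N) × (Fin n → N))) := fun i =>
    {R | ∃ b, (∀ ψ ∈ Γ.type i, ψ.Realize (Sum.elim c b)) ∧ R = Γ.member i c b}
  have hpart : ∀ i, part i ⊆ Γ.members c := fun i R ⟨b, hb, hR⟩ => ⟨i, b, hb, hR⟩
  have hnet : ∀ i, ∃ R ⊆ part i, R.Finite ∧ ∀ a ∈ part i, a ∈ R ∨ ∃ b ∈ R,
      (G.differenceImage c a b).Finite ∨ (G.differenceImage c b a).Finite := by
    intro i
    refine (exists_pairwise_or_finite_net (part i)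
      fun R S => (G.differenceImage c R S).Finite).resolve_left fun hm => hno i N _ f fun m => ?_
    obtain ⟨g, hg, hr⟩ := hm m
    choose b hb hgb using hg
    refine ⟨b, hb, fun j k hjk => ?_⟩
    have := hr j k hjk
    rwa [hgb j, hgb k] at this
  choose R hRp hR hnet using hnet
  refine hN.not_ge ?_
  refine (mk_le_of_surjective (α := Σ i, R i)
    (f := fun p => Quot.mk _ ⟨p.2.1, hpart p.1 (hRp p.1 p.2.2)⟩) ?_).trans ?_
  · rintro ⟨⟨S, i, b, hb, hS⟩⟩
    rcases hnet i S ⟨b, hb, hS⟩ with hSR | ⟨S', hS', hr | hr⟩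
    · exact ⟨⟨i, S, hSR⟩, rfl⟩
    · exact ⟨⟨i, S', hS'⟩, (Quot.sound hr).symm⟩
    · exact ⟨⟨i, S', hS'⟩, Quot.sound hr⟩
  · rw [mk_sigma, ← sum_const']
    exact sum_le_sum _ _ fun i => (hR i).lt_aleph0.le

variable {κ : Cardinal.{u}}

/-- By saturation, having many inequivalent members passes from an elementary extension to `M`. -/
theorem HasManyMembers.of_extension (hM : IsSaturated L κ M) (hC : #C < κ) {i : Γ.ι} {N : Type u}
    [L.Structure N] (f : M ↪ₑ[L] N) (h : G.HasManyMembers Γ i (fun c : C => f c)) :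
    G.HasManyMembers Γ i (Subtype.val : C → M) := by
  intro m
  choose θ hθ using G.exists_formula_differenceImage Γ i
  let F : (Fin m × Γ.type i) ⊕ ({p : Fin m × Fin m // p.1 ≠ p.2} × ℕ) →
      L.Formula (C ⊕ (Fin m × Fin (Γ.arity i))) :=
    Sum.elim (fun p => p.2.1.relabel (Sum.map id fun t => (p.1, t)))
      fun p => (θ p.2).relabel (Sum.map id (Sum.elim (fun t => (p.1.1.1, t)) fun t => (p.1.1.2, t)))
  have hF : ∀ (N : Type u) [L.Structure N] (c : C → N) (x : Fin m × Fin (Γ.arity i) → N),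
      (∀ a, (F a).Realize (Sum.elim c x)) ↔
        (∀ j, ∀ ψ ∈ Γ.type i, ψ.Realize (Sum.elim c fun t => x (j, t))) ∧
        ∀ j k, j ≠ k → ¬ (G.differenceImage c (Γ.member i c fun t => x (j, t))
          (Γ.member i c fun t => x (k, t))).Finite := by
    intro N _ c x
    have h1 : ∀ j : Fin m, Sum.elim c x ∘ Sum.map id (fun t => (j, t)) =
        Sum.elim c fun t => x (j, t) := by
      intro j
      ext y
      cases y <;> rfl
    have h2 : ∀ j k : Fin m, Sum.elim c x ∘
        Sum.map id (Sum.elim (fun t => (j, t)) fun t => (k, t)) =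
        Sum.elim c (Sum.elim (fun t => x (j, t)) fun t => x (k, t)) := by
      intro j k
      ext y
      rcases y with y | y | y <;> rfl
    simp only [Sum.forall, F, Sum.elim_inl, Sum.elim_inr, Formula.realize_relabel, h1, h2, hθ,
      Prod.forall, Subtype.forall, infinite_iff_forall_injective]
  obtain ⟨b, hb⟩ := h m
  obtain ⟨x, hx⟩ := hM.exists_realize_of_extension hC Subtype.val f F
    (x := fun p => b p.1 p.2) ((hF N _ _).2 hb)
  exact ⟨fun j t => x (j, t), (hF M _ _).1 hx⟩

theorem exists_element (hΓ : G.IsInvariantPreRing Γ) {i : Γ.ι} {b : Fin (Γ.arity i) → M}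
    (hb : ∀ ψ ∈ Γ.type i, ψ.Realize (Sum.elim (Subtype.val : C → M) b)) :
    ∃ γ ∈ G.elements Γ, G.pairs γ = Γ.member i Subtype.val b := by
  have hmem : Γ.member i Subtype.val b ∈ Γ.members (Subtype.val : C → M) := ⟨i, b, hb, rfl⟩
  obtain ⟨γ, -, h⟩ := hΓ.1 _ hmem
  exact ⟨γ, show G.pairs γ ∈ _ by rwa [h], h⟩

theorem mem_pairs {γ : AddSubgroup (G.Carrier × G.Carrier)} {a b : G.Carrier} :
    (a.1, b.1) ∈ G.pairs γ ↔ (a, b) ∈ γ := by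
  constructor
  · rintro ⟨p, hp, h1, h2⟩
    rwa [← Subtype.ext h1, ← Subtype.ext h2]
  · exact fun h => ⟨_, h, rfl, rfl⟩

theorem differenceImage_pairs (γ γ' : AddSubgroup (G.Carrier × G.Carrier)) :
    G.differenceImage Subtype.val (G.pairs γ) (G.pairs γ') =
      Subtype.val '' (image (subE γ γ') ⊤ : Set G.Carrier) := by
  ext z
  constructor
  · rintro ⟨hz, _, _, _, ⟨⟨x, y⟩, h, rfl, rfl⟩, ⟨⟨x', y'⟩, h', he, rfl⟩, hadd⟩
    obtain rfl : x' = x := Subtype.ext he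
    have := (G.add_iff ⟨z, hz⟩ y' y).1 hadd
    exact ⟨⟨z, hz⟩, ⟨x', trivial, mem_subE.2 ⟨y, y', h, h', by rw [← this, add_sub_cancel_right]⟩⟩,
      rfl⟩
  · rintro ⟨z, ⟨x, -, hz⟩, rfl⟩
    obtain ⟨y, y', h, h', rfl⟩ := mem_subE.1 hz
    exact ⟨(y - y').2, x.1, y.1, y'.1, mem_pairs.2 h, mem_pairs.2 h',
      (G.add_iff _ _ _).2 (sub_add_cancel y y')⟩

theorem finite_differenceImage_iff {γ γ' : AddSubgroup (G.Carrier × G.Carrier)} :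
    (G.differenceImage Subtype.val (G.pairs γ) (G.pairs γ')).Finite ↔ EquivalentOn ⊤ γ γ' := by
  rw [differenceImage_pairs, Set.finite_image_iff Subtype.val_injective.injOn, EquivalentOn]

theorem HasManyMembers.hasManyOn (hΓ : G.IsInvariantPreRing Γ) {i : Γ.ι}
    (h : G.HasManyMembers Γ i (Subtype.val : C → M)) : HasManyOn (G.elements Γ) ⊤ := by
  intro m
  obtain ⟨b, hb, hr⟩ := h m
  choose γ hγ hγb using fun j => exists_element hΓ (hb j)
  refine ⟨γ, hγ, fun j k hjk => ?_⟩
  rw [← finite_differenceImage_iff, hγb, hγb]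
  exact hr j k hjk

/-- Let `Y` be a countable set such that every `γ ∈ Γ` takes some value in `Y` at every point of
`Y`. By compactness, for the members of one part of `Γ` the value at `y ∈ Y` can be chosen in a
finite set that depends only on `y`. Hence two among sufficiently many inequivalent members have a
common value at finitely many given points, and by saturation there are two inequivalent members
that have a common value at all the points of `Y`. -/
theorem HasManyMembers.exists_ker_le (hM : IsSaturated L κ M) (hκ : ℵ₀ < κ) (hC : #C < κ)
    (hΓ : G.IsInvariantPreRing Γ) {i : Γ.ι} (h : G.HasManyMembers Γ i (Subtype.val : C → M))
    {Y : Set G.Carrier} (hY : Y.Countable)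
    (hYΓ : ∀ γ ∈ G.elements Γ, ∀ y ∈ Y, ∃ z ∈ Y, (y, z) ∈ γ) :
    ∃ γ ∈ G.elements Γ, (¬ (image γ ⊤ : Set G.Carrier).Finite) ∧ ∀ y ∈ Y, (y, 0) ∈ γ := by
  classical
  let W := C ⊕ (Y × Fin n)
  have hW : #W < κ := by
    have : Countable Y := hY
    have h2 : #(Y × Fin n) ≤ ℵ₀ := mk_le_aleph0
    have h3 : #W = #C + #(Y × Fin n) := by simp only [W, mk_sum, lift_id]
    rw [h3]
    exact add_lt_of_lt hκ.le hC (h2.trans_lt hκ)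
  let w : W → M := Sum.elim Subtype.val fun p => p.1.1.1 p.2
  let val : C → M := Subtype.val
  -- the finite sets of values
  have hZ : ∀ y : Y, ∃ Z : Finset G.Carrier, ∀ b : Fin (Γ.arity i) → M,
      (∀ ψ ∈ Γ.type i, ψ.Realize (Sum.elim val b)) → ∃ z ∈ Z, (y.1.1, z.1) ∈ Γ.member i val b := by
    intro y
    by_contra! hno
    let F : Γ.type i ⊕ Y → L.Formula (W ⊕ Fin (Γ.arity i)) := Sum.elim
      (fun ψ => ψ.1.relabel (Sum.map Sum.inl id))
      fun z => ((Γ.formula i).relabel (Sum.elim (fun c => .inl (.inl c)) (Sum.elim (fun t => .inr t)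
        (Sum.elim (fun t => .inl (.inr (y, t))) fun t => .inl (.inr (z, t)))))).not
    have hF1 : ∀ ψ b, (F (.inl ψ)).Realize (Sum.elim w b) ↔ ψ.1.Realize (Sum.elim val b) := by
      intro ψ b
      simp only [F, Sum.elim_inl, Formula.realize_relabel]
      apply iff_of_eq
      congr 1
      ext t
      rcases t with t | t <;> rfl
    have hF2 : ∀ z b, (F (.inr z)).Realize (Sum.elim w b) ↔
        (y.1.1, z.1.1) ∉ Γ.member i val b := by
      intro z b
      simp only [F, Sum.elim_inr, Formula.realize_not, Formula.realize_relabel]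
      apply iff_of_eq
      congr 2
      ext t
      rcases t with t | t | t | t <;> rfl
    obtain ⟨b, hb⟩ := hM.exists_realize hW w F fun s => by
      obtain ⟨b, hb, hbZ⟩ := hno ((s.preimage Sum.inr Sum.inr_injective.injOn).image Subtype.val)
      refine ⟨b, fun a ha => ?_⟩
      rcases a with ψ | z
      · exact (hF1 ψ b).2 (hb _ ψ.2)
      · refine (hF2 z b).2 (hbZ _ ?_)
        simpa using ha
    obtain ⟨γ, hγ, hγb⟩ := exists_element hΓ fun ψ hψ => (hF1 ⟨ψ, hψ⟩ b).1 (hb (.inl ⟨ψ, hψ⟩))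
    obtain ⟨z, hz, hyz⟩ := hYΓ γ hγ y y.2
    refine (hF2 ⟨z, hz⟩ b).1 (hb (.inr ⟨z, hz⟩)) ?_
    rw [← hγb]
    exact mem_pairs.2 hyz
  choose Z hZ using hZ
  choose θ hθ using G.exists_formula_differenceImage Γ i
  -- the type of a pair of inequivalent parameters with common values at the points of `Y`
  let F : (Γ.type i ⊕ Γ.type i) ⊕ (ℕ ⊕ Y) → L.Formula (W ⊕ (Fin (Γ.arity i) ⊕ Fin (Γ.arity i))) :=
    Sum.elim (Sum.elim (fun ψ => ψ.1.relabel (Sum.map Sum.inl Sum.inl))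
        fun ψ => ψ.1.relabel (Sum.map Sum.inl Sum.inr))
      (Sum.elim (fun k => (θ k).relabel (Sum.map Sum.inl id))
        fun y => Formula.iExs (Fin n)
          (((Γ.formula i).relabel (Sum.elim (fun c => .inl (.inl (.inl c)))
            (Sum.elim (fun t => .inl (.inr (.inl t)))
              (Sum.elim (fun t => .inl (.inl (.inr (y, t)))) fun t => .inr t)))) ⊓
          ((Γ.formula i).relabel (Sum.elim (fun c => .inl (.inl (.inl c)))
            (Sum.elim (fun t => .inl (.inr (.inr t)))
              (Sum.elim (fun t => .inl (.inl (.inr (y, t)))) fun t => .inr t))))))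
  have hF1 : ∀ ψ b b', (F (.inl (.inl ψ))).Realize (Sum.elim w (Sum.elim b b')) ↔
      ψ.1.Realize (Sum.elim val b) := by
    intro ψ b b'
    simp only [F, Sum.elim_inl, Formula.realize_relabel]
    apply iff_of_eq
    congr 1
    ext t
    rcases t with t | t <;> rfl
  have hF2 : ∀ ψ b b', (F (.inl (.inr ψ))).Realize (Sum.elim w (Sum.elim b b')) ↔
      ψ.1.Realize (Sum.elim val b') := by
    intro ψ b b'
    simp only [F, Sum.elim_inl, Sum.elim_inr, Formula.realize_relabel]
    apply iff_of_eq
    congr 1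
    ext t
    rcases t with t | t <;> rfl
  have hF3 : ∀ k b b', (F (.inr (.inl k))).Realize (Sum.elim w (Sum.elim b b')) ↔
      ∃ f : Fin k → Fin n → M, f.Injective ∧
        ∀ j, f j ∈ G.differenceImage val (Γ.member i val b) (Γ.member i val b') := by
    intro k b b'
    rw [← hθ]
    simp only [F, Sum.elim_inl, Sum.elim_inr, Formula.realize_relabel]
    apply iff_of_eq
    congr 1
    ext t
    rcases t with t | t | t <;> rfl
  have hF4 : ∀ y b b', (F (.inr (.inr y))).Realize (Sum.elim w (Sum.elim b b')) ↔
      ∃ z, (y.1.1, z) ∈ Γ.member i val b ∧ (y.1.1, z) ∈ Γ.member i val b' := by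
    intro y b b'
    simp only [F, Sum.elim_inr, Formula.realize_iExs, Formula.realize_inf, Formula.realize_relabel]
    refine exists_congr fun z => and_congr (iff_of_eq ?_) (iff_of_eq ?_) <;>
    · congr 1
      ext t
      rcases t with t | t | t | t <;> rfl
  obtain ⟨x, hx⟩ := hM.exists_realize hW w F fun s => by
    let Y₀ : Finset Y := (s.preimage Sum.inr Sum.inr_injective.injOn).preimage Sum.inr
      Sum.inr_injective.injOn
    obtain ⟨k, ⟨e⟩⟩ := Finite.exists_equiv_fin (∀ y : Y₀, Z y.1)
    obtain ⟨b, hb, hr⟩ := h (k + 1)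
    choose g hgZ hg using fun (j : Fin (k + 1)) (y : Y₀) => hZ y.1 (b j) (hb j)
    obtain ⟨j, l, hjl, he⟩ := Fintype.exists_ne_map_eq_of_card_lt
      (fun j : Fin (k + 1) => e fun y => ⟨g j y, hgZ j y⟩) (by simp)
    have he := e.injective he
    refine ⟨Sum.elim (b j) (b l), fun a ha => ?_⟩
    rcases a with (ψ | ψ) | (m | y)
    · exact (hF1 _ _ _).2 (hb j _ ψ.2)
    · exact (hF2 _ _ _).2 (hb l _ ψ.2)
    · exact (hF3 _ _ _).2 ((infinite_iff_forall_injective _).1 (hr j l hjl) m)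
    · have hy : y ∈ Y₀ := by simpa [Y₀] using ha
      refine (hF4 _ _ _).2 ⟨(g j ⟨y, hy⟩).1, hg j ⟨y, hy⟩, ?_⟩
      rw [show g j ⟨y, hy⟩ = g l ⟨y, hy⟩ from congrArg Subtype.val (congrFun he ⟨y, hy⟩)]
      exact hg l ⟨y, hy⟩
  rw [← Sum.elim_comp_inl_inr x] at hx
  obtain ⟨γ, hγ, hγb⟩ := exists_element hΓ
    fun ψ hψ => (hF1 ⟨ψ, hψ⟩ _ _).1 (hx (.inl (.inl ⟨ψ, hψ⟩)))
  obtain ⟨γ', hγ', hγb'⟩ := exists_element hΓ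
    fun ψ hψ => (hF2 ⟨ψ, hψ⟩ _ _).1 (hx (.inl (.inr ⟨ψ, hψ⟩)))
  refine ⟨subE γ γ', hΓ.2.sub_mem hγ hγ', ?_, fun y hy => ?_⟩
  · have := (infinite_iff_forall_injective _).2 fun k => (hF3 k _ _).1 (hx (.inr (.inl k)))
    rwa [← hγb, ← hγb', finite_differenceImage_iff] at this
  · obtain ⟨z, hz, hz'⟩ := (hF4 ⟨y, hy⟩ _ _).1 (hx (.inr (.inr ⟨y, hy⟩)))
    rw [← hγb] at hz
    rw [← hγb'] at hz'
    obtain ⟨⟨y₁, z₁⟩, h1, h2, rfl⟩ := hz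
    obtain rfl : y₁ = y := Subtype.ext h2
    exact mem_subE.2 ⟨z₁, z₁, h1, mem_pairs.1 hz', sub_self _⟩

end DefAbGroup

/-! ### The action modulo a finite invariant subgroup -/

theorem quotActsByEndomorphisms {A : Type u} [AddCommGroup A] {Θ : Set (AddSubgroup (A × A))}
    {F : AddSubgroup A} (hΘ : ∀ θ ∈ Θ, IsEndogeny θ) (hF : IsInvariant Θ F)
    (hsub : ∀ θ ∈ Θ, ∀ θ' ∈ Θ, Equivalent θ θ' → image (subE θ θ') ⊤ ≤ F) :
    QuotActsByEndomorphisms Θ F := by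
  choose g hg using fun θ : Θ => inducesEndomorphism (hΘ θ.1 θ.2) (hF θ.1 θ.2)
  have hext : ∀ (θ : Θ) (f : A ⧸ F →+ A ⧸ F),
      (∀ a, ∃ b, (a, b) ∈ θ.1 ∧ f (a : A ⧸ F) = (b : A ⧸ F)) → g θ = f := by
    intro θ f h
    ext a
    obtain ⟨b, hb, hf⟩ := h a
    exact (hg θ a b hb).trans hf.symm
  have hρ : ∀ θ θ' : Θ, Equivalent θ.1 θ'.1 → g θ = g θ' := by
    intro θ θ' h
    refine hext θ _ fun a => ?_
    obtain ⟨b, hb⟩ := (hΘ θ.1 θ.2).1 a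
    obtain ⟨b', hb'⟩ := (hΘ θ'.1 θ'.2).1 a
    refine ⟨b, hb, (hg θ' a b' hb').trans (QuotientAddGroup.eq_iff_sub_mem.2 ?_)⟩
    rw [← neg_mem_iff, neg_sub]
    exact hsub θ.1 θ.2 θ'.1 θ'.2 h ⟨a, trivial, mem_subE.2 ⟨b, b', hb, hb', rfl⟩⟩
  refine ⟨Quot.lift g hρ, hg, fun θ h => ?_, fun θ h => ?_, fun θ₁ θ₂ θ₃ h => ?_,
    fun θ₁ θ₂ θ₃ h => ?_⟩
  · exact hext θ 0 fun a => ⟨0, by rw [h, mem_zeroE], rfl⟩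
  · exact hext θ (AddMonoidHom.id _) fun a => ⟨a, by rw [h, mem_oneE], rfl⟩
  · refine hext θ₃ (g θ₁ + g θ₂) fun a => ?_
    obtain ⟨b, hb⟩ := (hΘ θ₁.1 θ₁.2).1 a
    obtain ⟨b', hb'⟩ := (hΘ θ₂.1 θ₂.2).1 a
    refine ⟨b + b', h ▸ ⟨b, b', hb, hb', rfl⟩, ?_⟩
    rw [AddMonoidHom.add_apply, hg θ₁ a b hb, hg θ₂ a b' hb']
    rfl
  · refine hext θ₃ ((g θ₁).comp (g θ₂)) fun a => ?_
    obtain ⟨b, hb⟩ := (hΘ θ₂.1 θ₂.2).1 a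
    obtain ⟨c, hc⟩ := (hΘ θ₁.1 θ₁.2).1 b
    refine ⟨c, h ▸ ⟨b, hb, hc⟩, ?_⟩
    rw [AddMonoidHom.comp_apply, hg θ₂ a b hb, hg θ₁ b c hc]

namespace DefAbGroup

variable {L : FirstOrder.Language.{u, u}} {M : Type u} [L.Structure M] {C : Set M} {n : ℕ}
  {G : DefAbGroup L C n} {X : Set (AddSubgroup (G.Carrier × G.Carrier))}
  {φ ψ : AddSubgroup (G.Carrier × G.Carrier)}

/-! ### Sharp centralizers -/

theorem isPreRing_sharpCentralizer (hX : X ⊆ G.defEndog) : IsPreRing (G.sharpCentralizer X) where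
  isEndogeny φ hφ := hφ.1.1
  zero_mem := ⟨mem_defEndog_iff.2 ⟨.zeroE, .zeroE⟩, fun _ _ => sharplyCommute_zeroE⟩
  one_mem := ⟨mem_defEndog_iff.2 ⟨.oneE, .oneE⟩, fun _ _ => sharplyCommute_oneE⟩
  add_mem φ hφ ψ hψ := by
    have hφ' := mem_defEndog_iff.1 hφ.1
    have hψ' := mem_defEndog_iff.1 hψ.1
    exact ⟨mem_defEndog_iff.2 ⟨hφ'.1.addE hψ'.1, hφ'.2.addE hψ'.2⟩,
      fun χ hχ => (hφ.2 χ hχ).addE (hX hχ).1 (hψ.2 χ hχ)⟩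
  neg_mem φ hφ := by
    have hφ' := mem_defEndog_iff.1 hφ.1
    exact ⟨mem_defEndog_iff.2 ⟨hφ'.1.negE, hφ'.2.negE⟩, fun χ hχ => (hφ.2 χ hχ).negE⟩
  comp_mem φ hφ ψ hψ := by
    have hφ' := mem_defEndog_iff.1 hφ.1
    have hψ' := mem_defEndog_iff.1 hψ.1
    exact ⟨mem_defEndog_iff.2 ⟨hφ'.1.compE hψ'.1, hφ'.2.compE hψ'.2⟩,
      fun χ hχ => SharplyCommute.compE hφ'.1 (hX hχ).1 (hφ.2 χ hχ) (hψ.2 χ hχ)⟩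

/-- If `K = (φ - ψ)[A]` is finite, then the constant relation `a ↦ K` is a definable endogeny that
sharply commutes with every relation with which `φ` and `ψ` do; its katakernel is `K`. -/
theorem image_subE_le_Kat (hX : X ⊆ G.defEndog) (hφ : φ ∈ G.sharpCentralizer X)
    (hψ : ψ ∈ G.sharpCentralizer X) (h : Equivalent φ ψ) :
    image (subE φ ψ) ⊤ ≤ Kat (G.sharpCentralizer X) := by
  have hχ : subE φ ψ ∈ G.sharpCentralizer X := (isPreRing_sharpCentralizer hX).sub_mem hφ hψ
  replace h : (image (subE φ ψ) ⊤ : Set G.Carrier).Finite := h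
  generalize subE φ ψ = χ at *
  let κ : AddSubgroup (G.Carrier × G.Carrier) := (⊤ : AddSubgroup G.Carrier).prod (image χ ⊤)
  have hκ : kat κ = image χ ⊤ := by
    ext b
    simp [mem_kat, κ, AddSubgroup.mem_prod]
  rw [← hκ]
  refine kat_le_Kat ⟨mem_defEndog_iff.2 ⟨⟨fun a => ⟨0, ?_⟩, ?_⟩, ?_⟩, fun θ hθ => ?_⟩
  · exact ⟨trivial, zero_mem _⟩
  · rw [hκ]
    exact h
  · exact .top_prod (.image (mem_defEndog_iff.1 hχ.1).2 .top)
  · rw [sharplyCommute_iff, hκ]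
    rintro a z x w y h1 ⟨-, hx⟩ ⟨-, b, -, hw⟩ h4
    -- `y ∈ θ[χ[b]]`, and `θχ` agrees with `χθ` modulo `kat χ + kat θ`
    obtain ⟨z', hz'⟩ := (hX hθ).1.1 b
    obtain ⟨x', hx'⟩ := hχ.1.1.1 z'
    have := sharplyCommute_iff.1 (hχ.2 θ hθ) b z' x' w y hz' hx' hw h4
    have e : x - y = (x - x') + (x' - y) := by abel
    rw [e]
    refine add_mem (AddSubgroup.mem_sup_left (sub_mem hx ⟨z', trivial, hx'⟩)) ?_
    exact sup_le_sup_right kat_le_image _ this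

variable {Γ Δ : InvariantFamily L C n}

theorem elements_subset_defEndog (hΓ : G.IsInvariantPreRing Γ) : G.elements Γ ⊆ G.defEndog := by
  intro γ hγ
  refine ⟨hΓ.2.isEndogeny γ hγ, ?_⟩
  obtain ⟨i, b, -, h⟩ := hγ
  rw [h]
  convert definable_setOf_realize ((Γ.formula i).relabel (Sum.elim (fun c => Sum.inl (Sum.inl c))
    (Sum.elim (fun t => Sum.inl (Sum.inr t)) Sum.inr))) (Sum.elim (Subtype.val : C → M) b) using 1
  ext v
  simp only [Set.mem_ofPred_eq, Formula.realize_relabel]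
  apply iff_of_eq
  congr 1
  ext t
  rcases t with t | t | t | t <;> rfl

variable {κ : Cardinal.{u}}

/-- The bikatakernel of a minimal pair of pre-rings is finite if both are essentially infinite and
the first one contains an essentially unbounded invariant pre-ring: the bikatakernel is countable,
so that it is killed by an element with infinite image. -/
theorem EssentiallyUnbounded.finite_biKat (hunb : G.EssentiallyUnbounded Γ)
    (hM : IsSaturated L κ M) (hκ : ℵ₀ < κ) (hC : #C < κ) (hΓ : G.IsInvariantPreRing Γ)
    {D : DimensionLattice G.Carrier} {Γ' Δ' : Set (AddSubgroup (G.Carrier × G.Carrier))}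
    (h : IsMinimalPair D Γ' Δ') (hsub : G.elements Γ ⊆ Γ') (hΔ' : HasManyOn Δ' ⊤) :
    (biKat Γ' Δ' : Set G.Carrier).Finite := by
  obtain ⟨i, N, _, f, hi⟩ := hunb.exists_hasManyMembers
  replace hi := hi.of_extension hM hC f
  have hcount := h.countable_biKat ((hi.hasManyOn hΓ).mono hsub) hΔ'
  have hinv := isInvariant_biKat_left h.left h.comm
  obtain ⟨γ, hγ, hγi, hγY⟩ := hi.exists_ker_le hM hκ hC hΓ hcount fun γ hγ y hy => by
    obtain ⟨z, hz⟩ := (hΓ.2.isEndogeny γ hγ).1 y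
    exact ⟨z, hinv γ (hsub hγ) ⟨y, hy, hz⟩, hz⟩
  exact h.finite_of_le_ker hinv (hsub hγ) hγi hγY

end DefAbGroup

end Endogenies

theorem theoremA {L : FirstOrder.Language.{u, u}} (T : L.Theory) (hT : IsFiniteDimensional T)
    (M : Type u) [L.Structure M] [Nonempty M] (hMT : M ⊨ T)
    (κ : Cardinal.{u}) (hκ : ℵ₀ < κ) (hL : L.card < κ) (hM : IsSaturated L κ M)
    (C : Set M) (hC : #C < κ) (n : ℕ) (A : DefAbGroup L C n)
    (Γ Δ : InvariantFamily L C n)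
    (hΓ : A.IsInvariantPreRing Γ) (hΔ : A.IsInvariantPreRing Δ)
    (hcomm : ∀ γ ∈ A.elements Γ, ∀ δ ∈ A.elements Δ, SharplyCommute γ δ)
    (hmin : A.AbsolutelyMinimal (A.elements Γ ∪ A.elements Δ))
    (hsize : (A.EssentiallyUnbounded Γ ∧ EssentiallyInfinite (A.elements Δ)) ∨
      (A.EssentiallyUnbounded Δ ∧ EssentiallyInfinite (A.elements Γ))) :
    ((biKat (A.elements Γ) (A.elements Δ) : Set A.Carrier).Finite ∧
      IsInvariant (A.elements Γ ∪ A.elements Δ) (biKat (A.elements Γ) (A.elements Δ)) ∧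
      ∀ γ ∈ A.elements Γ ∪ A.elements Δ,
        InducesEndomorphism γ (biKat (A.elements Γ) (A.elements Δ))) ∧
    ∃ F : AddSubgroup A.Carrier,
      F = biKat (A.sharpCentralizer (A.sharpCentralizer (A.elements Γ)))
        (A.sharpCentralizer (A.elements Γ)) ∧
      (F : Set A.Carrier).Finite ∧
      biKat (A.elements Γ) (A.elements Δ) ≤ F ∧
      IsInvariant (A.elements Γ ∪ A.elements Δ) F ∧
      QuotActsByEndomorphisms (A.elements Γ) F ∧
      QuotActsByEndomorphisms (A.elements Δ) F := by
  obtain ⟨D⟩ := hT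
  have hΓd := DefAbGroup.elements_subset_defEndog hΓ
  have hΔd := DefAbGroup.elements_subset_defEndog hΔ
  set Δ' := A.sharpCentralizer (A.elements Γ) with hΔ'
  set Γ' := A.sharpCentralizer Δ' with hΓ'
  have hΔ'd : Δ' ⊆ A.defEndog := fun _ h => h.1
  have hΓsub : A.elements Γ ⊆ Γ' := fun γ hγ => ⟨hΓd hγ, fun δ hδ => (hδ.2 γ hγ).symm⟩
  have hΔsub : A.elements Δ ⊆ Δ' := fun δ hδ => ⟨hΔd hδ, fun γ hγ => (hcomm γ hγ δ hδ).symm⟩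
  have hcompat : ∀ γ ∈ A.defEndog,
      (A.dimensionLattice D hMT (hM.mono hκ.le)).Compatible γ := fun γ hγ =>
    ⟨.ker (DefAbGroup.mem_defEndog_iff.1 hγ).2,
      fun B hB => .image (DefAbGroup.mem_defEndog_iff.1 hγ).2 hB⟩
  have hpair : IsMinimalPair (A.dimensionLattice D hMT (hM.mono hκ.le)) Γ' Δ' :=
    { left := DefAbGroup.isPreRing_sharpCentralizer hΔ'd
      right := DefAbGroup.isPreRing_sharpCentralizer hΓd
      comm γ hγ δ hδ := hγ.2 δ hδ
      compatible_left γ hγ := hcompat γ hγ.1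
      compatible_right δ hδ := hcompat δ hδ.1
      minimal B hB hi hinv := hmin B hB hi fun γ hγ =>
        hinv γ (Set.union_subset_union hΓsub hΔsub hγ) }
  have hfin : (biKat Γ' Δ' : Set A.Carrier).Finite := by
    rcases hsize with ⟨hunb, hinf⟩ | ⟨hunb, hinf⟩
    · exact hunb.finite_biKat hM hκ hC hΓ hpair hΓsub (hinf.hasManyOn.mono hΔsub)
    · rw [biKat_comm]
      exact hunb.finite_biKat hM hκ hC hΔ hpair.symm hΔsub (hinf.hasManyOn.mono hΓsub)
  have hle : biKat (A.elements Γ) (A.elements Δ) ≤ biKat Γ' Δ' :=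
    sup_le_sup (Kat_mono hΓsub) (Kat_mono hΔsub)
  have hinv := isInvariant_biKat hΓ.2 hΔ.2 hcomm
  have hinv' : IsInvariant (A.elements Γ ∪ A.elements Δ) (biKat Γ' Δ') := fun γ hγ =>
    isInvariant_biKat hpair.left hpair.right hpair.comm γ
      (Set.union_subset_union hΓsub hΔsub hγ)
  refine ⟨⟨hfin.subset hle, hinv, fun γ hγ => inducesEndomorphism ?_ (hinv γ hγ)⟩,
    _, rfl, hfin, hle, hinv', ?_, ?_⟩
  · exact hγ.elim (fun h => (hΓd h).1) fun h => (hΔd h).1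
  · exact quotActsByEndomorphisms (fun γ hγ => (hΓd hγ).1) (fun γ hγ => hinv' γ (.inl hγ))
      fun γ hγ γ' hγ' h =>
        (DefAbGroup.image_subE_le_Kat hΔ'd (hΓsub hγ) (hΓsub hγ') h).trans le_sup_left
  · exact quotActsByEndomorphisms (fun δ hδ => (hΔd hδ).1) (fun δ hδ => hinv' δ (.inr hδ))
      fun δ hδ δ' hδ' h =>
        (DefAbGroup.image_subE_le_Kat hΓd (hΔsub hδ) (hΔsub hδ') h).trans le_sup_right
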